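/- **Setting.** Let $x_0,x_t\in\mathbb R^d$, $\theta\in\mathbb R^k$, $T>0$, $\tau>0$. Let $c\sim\mathcal C$ (prompt), $z\sim p_z$ (latent) and $\omega\sim\nu$ (noise) be random elements of arbitrary probability spaces. A forward noising process on $(0,T]$ is a measurable map $x_t=F(x_0,\omega,t)$ such that, for each $x_0\in\mathbb R^d$ and $t\in(0,T]$, the random vector $F(x_0,\omega,t)$ has density $q_t(\cdot\,|\,x_0)$, jointly measurable in $(t,x_0,x)$. Let $q_0(\cdot\,|\,c)$ be a probability law on $\mathbb R^d$ depending measurably on $c$, let $r(x_0,c)$ be a measurable reward with $Z(c)=\int e^{r(x_0,c)/\tau}q_0(\mathrm dx_0|c)<\infty$ for every $c$, and put $$q_t(x|c)=\int q_t(x|x_0)\,q_0(\mathrm dx_0|c),\quad q^*(\mathrm dx_0|c)=\tfrac1{Z(c)}e^{r(x_0,c)/\tau}q_0(\mathrm dx_0|c),\quad q_t^*(x|c)=\int q_t(x|x_0)\,q^*(\mathrm dx_0|c).$$ The posterior is $q(\mathrm dx_0|x_t,c)=\frac{q_t(x_t|x_0)}{q_t(x_t|c)}\,q_0(\mathrm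 dx_0|c)$. The one-step generator $g_\theta(z,c)\in\mathbb R^d$ is measurable in $(z,c)$; $p_{\theta,0}(\cdot|c)$ is the law of $g_\theta(z,c)$ and $p_{\theta,t}(x|c)=\int q_t(x|x_0)\,p_{\theta,0}(\mathrm dx_0|c)$. With a measurable weight $w\ge0$ on $(0,T]$, the Integral-KL objective is $$\mathcal L(\theta)=\mathbb E_{c\sim\mathcal C}\Big[\int_0^T w(t)\,\mathrm{KL}\big(p_{\theta,t}(\cdot|c)\,\big\|\,q_t^*(\cdot|c)\big)\,\mathrm dt\Big].$$ Define $$s_\theta=\nabla_{x_t}\log p_{\theta,t}(x_t|c),\quad s_{\rm ref}=\nabla_{x_t}\log q_t(x_t|c),\quad s_r=\nabla_{x_t}\log\mathbb E_{x_0\sim q(x_0|x_t,c)}\big[e^{r(x_0,c)/\tau}\big].$$ **Regularity.** (a) There is $L$ such that for all $t\in(0,T]$ and all $\omega$ the map $F(\cdot,\omega,t)$ is differentiable with Jacobian of norm at most $L$, and $\mathbb E\|F(0,\omega,t)\|^2<\infty$ for all $t\in(0,T]$. For $t\in(0,T]$ the density $q_t(x|x_0)$ is positive, differentiable in $x$,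 and of Gaussian type: there are $A_t,K_t,D_t\in\mathbb R$ with $\log q_t(x|x_0)\le A_t$ for all $x,x_0$, such that $\psi_t(x_0,x)=\sqrt{A_t-\log q_t(x|x_0)}$ satisfies $|\psi_t(x_0,x)-\psi_t(y_0,y)|\le K_t(\|x_0-y_0\|+\|x-y\|)$ and $\int\psi_t(x_0,x)^2q_t(x|x_0)\,\mathrm dx\le D_t$ for all $x_0$. (For example, $x_t=\alpha_tx_0+\sigma_t\varepsilon$ with $\varepsilon$ standard Gaussian, $\sigma_t>0$ and $\alpha_t$ bounded.) (b) $g_\theta(z,c)$ is differentiable in $\theta$; for each $\theta$, $\mathbb E_z\|g_\theta(z,c)\|^2<\infty$ for almost every $c$; and each $\theta_0$ has a neighbourhood $U$ and a function $G\in L^2(\mathcal C\otimes p_z)$ such that for almost every $(c,z)$, $\|\partial_\theta g_\theta(z,c)\|\le G(c,z)$ for all $\theta\in U$. (c) $\mathcal L(\theta)<\infty$ for all $\theta$, and the relative Fisher information is locally bounded in $\theta$: each $\theta_0$ has a neighbourhood $U$ and functions $\beta(t)$, $b(c)$ with $\int_0^Tw(t)|\beta(t)|\,\mathrm dt<\infty$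 and $b\in L^2(\mathcal C)$ such that for almost every $c$, all $t\in(0,T]$ and all $\theta\in U$, $$\int p_{\theta,t}(x|c)\,\big\|\nabla\log p_{\theta,t}(x|c)-\nabla\log q^*_t(x|c)\big\|^2\,\mathrm dx\le\beta(t)^2b(c)^2 .$$ **Theorem.** Let $\pi$ be a probability density on $(0,T]$ that is positive everywhere on $(0,T]$. Then $\mathcal L$ is differentiable at every $\theta$, and $$\nabla_\theta\mathcal L(\theta)=\mathbb E_{\substack{c\sim\mathcal C,\;z\sim p_z,\;\omega\sim\nu,\;t\sim\pi\\ x_0=g_\theta(z,c),\;x_t=F(x_0,\omega,t)}}\Big[\tfrac{w(t)}{\pi(t)}\Big(\tfrac{\partial x_t}{\partial\theta}\Big)^{\!\top}\big(s_\theta(x_t,t,c)-s_{\rm ref}(x_t,t,c)-s_r(x_t,t,c)\big)\Big],$$ where the expectation converges absolutely. Moreover, for all $c$, $t\in(0,T]$, $x_t\in\mathbb R^d$ and $\theta$, the densities $p_{\theta,t}(x_t|c)$, $q_t(x_t|c)$ and $q^*_t(x_t|c)$ are positive, the posterior expectation of $e^{r/\tau}$ is finite, $\log p_{\theta,t}$,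 $\log q_t$, $\log q_t^*$ and $\log\mathbb E_{x_0\sim q(x_0|x_t,c)}[e^{r(x_0,c)/\tau}]$ are differentiable in $x_t$, and $$\nabla_{x_t}\log q_t^*(x_t|c)=s_{\rm ref}(x_t,t,c)+s_r(x_t,t,c).$$ -/

import Mathlib

open MeasureTheory ProbabilityTheory Set
open scoped ENNReal

namespace DIDR

/-- Images and parameters live in Euclidean spaces. -/
abbrev Vec (d : ℕ) := EuclideanSpace ℝ (Fin d)

noncomputable section

/-- A forward noising process on `(0, T]`, in reparametrized form `x_t = F x₀ ω t` with noise
`ω ∼ ν`: for every clean image `x₀` the law of `x_t` has the density `q t x₀ ·`, i.e. `q` is the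
transition kernel `q_t(x_t | x₀)`. -/
structure IsNoisingProcess {d : ℕ} {W : Type*} [MeasurableSpace W] (ν : Measure W) (T : ℝ)
    (F : Vec d → W → ℝ → Vec d) (q : ℝ → Vec d → Vec d → ℝ) : Prop where
  measurable_F : Measurable fun p : Vec d × W × ℝ => F p.1 p.2.1 p.2.2
  measurable_q : Measurable fun p : ℝ × Vec d × Vec d => q p.1 p.2.1 p.2.2
  law_eq : ∀ t ∈ Ioc 0 T, ∀ x₀ : Vec d,
    ν.map (fun ω => F x₀ ω t) = volume.withDensity fun x => ENNReal.ofReal (q t x₀ x)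

/-- Regularity of the forward process. The maps `x₀ ↦ x_t` are differentiable with uniformly
bounded Jacobian and `x_t` has finite second moments; the transition density is positive,
differentiable in `x_t`, and of Gaussian type: `q t x₀ x = exp (A - ψ²)` with `ψ ≥ 0` Lipschitz in
`(x₀, x)` and `ψ²` of mean bounded uniformly in `x₀`; the constants may depend on `t` in any way.
For `x_t = α_t x₀ + σ_t ε` with `ε` standard Gaussian one has `ψ = ‖x - α_t x₀‖ / (√2 σ_t)`. -/
structure IsRegularNoising {d : ℕ} {W : Type*} [MeasurableSpace W] (ν : Measure W) (T : ℝ)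
    (F : Vec d → W → ℝ → Vec d) (q : ℝ → Vec d → Vec d → ℝ) (L : ℝ) : Prop where
  differentiable_F : ∀ t ∈ Ioc 0 T, ∀ ω, Differentiable ℝ fun x₀ => F x₀ ω t
  norm_fderiv_F_le : ∀ t ∈ Ioc 0 T, ∀ ω x₀, ‖fderiv ℝ (fun y => F y ω t) x₀‖ ≤ L
  memLp_F : ∀ t ∈ Ioc 0 T, MemLp (fun ω => F 0 ω t) 2 ν
  pos : ∀ t ∈ Ioc 0 T, ∀ x₀ x, 0 < q t x₀ x
  differentiable_q : ∀ t ∈ Ioc 0 T, ∀ x₀, Differentiable ℝ (q t x₀)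
  gaussian_type : ∀ t ∈ Ioc 0 T, ∃ A K D : ℝ,
    (∀ x₀ x, Real.log (q t x₀ x) ≤ A) ∧
    (∀ x₀ x y₀ y, |√(A - Real.log (q t x₀ x)) - √(A - Real.log (q t y₀ y))|
      ≤ K * (‖x₀ - y₀‖ + ‖x - y‖)) ∧
    (∀ x₀, ∫⁻ x, ENNReal.ofReal ((A - Real.log (q t x₀ x)) * q t x₀ x) ≤ ENNReal.ofReal D)

/-- Density at `x_t = x` of the noised marginal `∫ q_t(x | x₀) μ(dx₀)` of a clean-image law `μ`. -/
def marginal {d : ℕ} (q : ℝ → Vec d → Vec d → ℝ) (μ : Measure (Vec d)) (t : ℝ) (x : Vec d) : ℝ :=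
  ∫ x₀, q t x₀ x ∂μ

/-- The noised marginal as a measure. -/
def marginalMeasure {d : ℕ} (q : ℝ → Vec d → Vec d → ℝ) (μ : Measure (Vec d)) (t : ℝ) :
    Measure (Vec d) :=
  volume.withDensity fun x => ENNReal.ofReal (marginal q μ t x)

/-- Stein score of the noised marginal of `μ`. -/
def score {d : ℕ} (q : ℝ → Vec d → Vec d → ℝ) (μ : Measure (Vec d)) (t : ℝ) (x : Vec d) : Vec d :=
  gradient (fun y => Real.log (marginal q μ t y)) x

/-- Bayes posterior `q(x₀ | x_t = x)` for the prior `μ`. -/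
def posterior {d : ℕ} (q : ℝ → Vec d → Vec d → ℝ) (μ : Measure (Vec d)) (t : ℝ) (x : Vec d) :
    Measure (Vec d) :=
  μ.withDensity fun x₀ => ENNReal.ofReal (q t x₀ x / marginal q μ t x)

/-- Reward-tilted law `q*(dx₀) = exp (r(x₀) / τ) μ(dx₀) / Z`. -/
def rewardTilted {d : ℕ} (μ : Measure (Vec d)) (r : Vec d → ℝ) (τ : ℝ) : Measure (Vec d) :=
  μ.tilted fun x₀ => r x₀ / τ

/-- `E_{x₀ ∼ q(x₀ | x_t = x)} [exp (r(x₀) / τ)]`. -/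
def posteriorExpReward {d : ℕ} (q : ℝ → Vec d → Vec d → ℝ) (μ : Measure (Vec d)) (r : Vec d → ℝ)
    (τ t : ℝ) (x : Vec d) : ℝ :=
  ∫ x₀, Real.exp (r x₀ / τ) ∂(posterior q μ t x)

/-- The Diffused Reward Score. -/
def diffusedRewardScore {d : ℕ} (q : ℝ → Vec d → Vec d → ℝ) (μ : Measure (Vec d)) (r : Vec d → ℝ)
    (τ t : ℝ) (x : Vec d) : Vec d :=
  gradient (fun y => Real.log (posteriorExpReward q μ r τ t y)) x

/-- Law `p_{θ,0}(· | c)` of the generated clean image `g z`, `z ∼ p_z`. -/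
def genLaw {d : ℕ} {Z : Type*} [MeasurableSpace Z] (pz : Measure Z) (g : Z → Vec d) :
    Measure (Vec d) :=
  pz.map g

/-- Relative Fisher information at time `t` of the noised marginal of `μ` with respect to the
noised marginal of `μ'`. -/
def fisherDiv {d : ℕ} (q : ℝ → Vec d → Vec d → ℝ) (μ μ' : Measure (Vec d)) (t : ℝ) : ℝ≥0∞ :=
  ∫⁻ x, ‖score q μ t x - score q μ' t x‖ₑ ^ 2 ∂(marginalMeasure q μ t)

/-- The Integral-KL objective `E_c ∫₀ᵀ w(t) KL(p_{θ,t}(· | c) ‖ q*_t(· | c)) dt`, with values in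
`[0, ∞]`. -/
def loss {d k : ℕ} {C Z : Type*} [MeasurableSpace C] [MeasurableSpace Z]
    (PC : Measure C) (pz : Measure Z) (T : ℝ) (w : ℝ → ℝ) (q : ℝ → Vec d → Vec d → ℝ)
    (q0 : Kernel C (Vec d)) (r : Vec d → C → ℝ) (τ : ℝ)
    (g : Vec k → Z → C → Vec d) (θ : Vec k) : ℝ≥0∞ :=
  ∫⁻ c, (∫⁻ t in Ioc 0 T, ENNReal.ofReal (w t) *
    InformationTheory.klDiv (marginalMeasure q (genLaw pz fun z => g θ z c) t)
      (marginalMeasure q (rewardTilted (q0 c) (fun x₀ => r x₀ c) τ) t)) ∂PC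

/-- Law on `(0, T]` with density `η`, from which the noise level is sampled. -/
def timeLaw (T : ℝ) (η : ℝ → ℝ) : Measure ℝ :=
  (volume.restrict (Ioc 0 T)).withDensity fun t => ENNReal.ofReal (η t)

/-- The vector-Jacobian product `(s_θ - s_ref - s_r)(x_t, t, c) · ∂x_t/∂θ`, where
`x_t = F (g θ z c) ω t`. -/
def scoreMismatchVJP {d k : ℕ} {C Z W : Type*} [MeasurableSpace C] [MeasurableSpace Z]
    (pz : Measure Z) (F : Vec d → W → ℝ → Vec d) (q : ℝ → Vec d → Vec d → ℝ)
    (q0 : Kernel C (Vec d)) (r : Vec d → C → ℝ) (τ : ℝ)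
    (g : Vec k → Z → C → Vec d) (θ : Vec k) (c : C) (z : Z) (ω : W) (t : ℝ) : Vec k :=
  ContinuousLinearMap.adjoint (fderiv ℝ (fun θ' => F (g θ' z c) ω t) θ)
    (score q (genLaw pz fun z' => g θ z' c) t (F (g θ z c) ω t)
      - score q (q0 c) t (F (g θ z c) ω t)
      - diffusedRewardScore q (q0 c) (fun x₀ => r x₀ c) τ t (F (g θ z c) ω t))

end

end DIDR

/-!
Fix the prompt and the noise level, write `p_θ` for the noised density of the generator, `p*` for
that of the reward-tilted law, and `X_θ` for the reparametrized sample. Since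
`KL(p_θ' ‖ p*) = E[(log p_θ - log p*)(X_θ')] + KL(p_θ' ‖ p_θ)`, the gradient of the divergence is
the pathwise derivative of the mean of a fixed function, provided that this function may be
differentiated under the expectation and that the second term is of second order in `θ' - θ`.

* The density of any mixture of kernels `exp (A - ψ²)` with `ψ` Lipschitz has a score bounded by
  `2 K √(A - log m)` (Jensen for `u log u`, `IsGaussianType.norm_fderiv_log_mix_le`), and
  `A - log m` grows at most quadratically, without any moment of the prior
  (`IsGaussianType.exists_sub_log_mix_le`). So log densities grow quadratically and scores linearly,
  which suffices for dominated convergence along a square integrable path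
  (`hasFDerivAt_integral_comp_path`).
* By joint convexity, `KL(p_θ' ‖ p_θ)` is at most the mean divergence of the kernels, which is
  `O(‖θ' - θ‖²)` (`IsGaussianType.lintegral_relEnt_mix_le`).

This gives `IsSampler.hasFDerivAt_klDiv`. The Cauchy-Schwarz inequality bounds this derivative by
the Fisher information (`IsSampler.integrable_scoreVJP`), locally uniformly in `θ`, so the derivative
passes under the integral over prompts and noise levels (`hasGradientAt_loss`). Joint measurability
comes from writing derivatives as limits of difference quotients and the divergence as an integral
of the densities.

The splitting of the target score is Bayes' rule: the posterior mean of `exp (r / τ)` is `Z` times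
the ratio of the tilted to the untilted noised density (`posteriorExpReward_eq`).
-/

namespace DIDR

open Filter Topology InformationTheory

/-! ### Derivatives depending measurably on a parameter -/

/-- Only pointwise differentiability is required: directional derivatives are limits of difference
quotients, and in finite dimension these determine the derivative. -/
lemma measurable_fderiv_param {α E G : Type*} [MeasurableSpace α]
    [NormedAddCommGroup E] [NormedSpace ℝ E] [FiniteDimensional ℝ E]
    [NormedAddCommGroup G] [NormedSpace ℝ G] [FiniteDimensional ℝ G] [MeasurableSpace G]
    [BorelSpace G]
    (f : α → E → G) (x : α → E) (hf : ∀ v, Measurable fun a => f a (x a + v))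
    (hd : ∀ a, DifferentiableAt ℝ (f a) (x a)) :
    StronglyMeasurable fun a => fderiv ℝ (f a) (x a) := by
  have happ : ∀ v, StronglyMeasurable fun a => fderiv ℝ (f a) (x a) v := by
    intro v
    have hlim : Tendsto (fun (n : ℕ) (a : α) => (n : ℝ) • (f a (x a + (n : ℝ)⁻¹ • v) - f a (x a)))
        atTop (𝓝 fun a => fderiv ℝ (f a) (x a) v) := by
      rw [tendsto_pi_nhds]
      intro a
      have h := (hd a).hasFDerivAt.lim (α := ℕ) (l := atTop) v
        (c := fun n => (n : ℝ)) (by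
          simpa using tendsto_natCast_atTop_atTop (R := ℝ))
      simpa using h
    refine stronglyMeasurable_of_tendsto atTop (fun n => ?_) hlim
    have h0 : Measurable fun a => f a (x a) := by simpa using hf 0
    exact (((hf _).sub h0).const_smul (n : ℝ)).stronglyMeasurable
  let b := Module.finBasis ℝ E
  have hrep : (fun a => fderiv ℝ (f a) (x a)) = fun a => ∑ i,
      ((b.coord i).toContinuousLinearMap).smulRight (fderiv ℝ (f a) (x a) (b i)) := by
    funext a
    ext v
    conv_lhs => rw [← b.sum_repr v, map_sum]
    simp
  rw [hrep]
  refine Finset.stronglyMeasurable_fun_sum _ fun i _ => ?_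
  have hc : Continuous fun y : G => ((b.coord i).toContinuousLinearMap).smulRight y :=
    (ContinuousLinearMap.smulRightL ℝ E G (b.coord i).toContinuousLinearMap).continuous
  exact hc.comp_stronglyMeasurable (happ (b i))

/-! ### Kernels of Gaussian type -/

/-- A transition density `k x₀ x = exp (A - ψ(x₀, x)²)` with `ψ = √(A - log k)` jointly
`K`-Lipschitz and with `ψ²` of mean at most `D` under every `k x₀`. -/
structure IsGaussianType {d : ℕ} (k : Vec d → Vec d → ℝ) (A K D : ℝ) : Prop where
  measurable : Measurable (Function.uncurry k)
  pos : ∀ x₀ x, 0 < k x₀ x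
  differentiable : ∀ x₀, Differentiable ℝ (k x₀)
  log_le : ∀ x₀ x, Real.log (k x₀ x) ≤ A
  nonneg_K : 0 ≤ K
  nonneg_D : 0 ≤ D
  lipschitz : ∀ x₀ x y₀ y, |√(A - Real.log (k x₀ x)) - √(A - Real.log (k y₀ y))|
      ≤ K * (‖x₀ - y₀‖ + ‖x - y‖)
  lintegral_le : ∀ x₀, ∫⁻ x, ENNReal.ofReal ((A - Real.log (k x₀ x)) * k x₀ x) ≤ ENNReal.ofReal D
  lintegral_eq_one : ∀ x₀, ∫⁻ x, ENNReal.ofReal (k x₀ x) = 1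

/-- The density at `x` of the mixture of the kernel `k` over the prior `μ`. -/
noncomputable def mix {d : ℕ} (k : Vec d → Vec d → ℝ) (μ : Measure (Vec d)) (x : Vec d) : ℝ :=
  ∫ x₀, k x₀ x ∂μ

lemma norm_fderiv_le_of_sqrt_lipschitz {E : Type*} [NormedAddCommGroup E] [NormedSpace ℝ E]
    {f : E → ℝ} {x : E} {A K : ℝ} (hK : 0 ≤ K) (hf : DifferentiableAt ℝ f x)
    (hA : ∀ y, f y ≤ A) (hL : ∀ y, |√(A - f y) - √(A - f x)| ≤ K * ‖y - x‖) :
    ‖fderiv ℝ f x‖ ≤ 2 * K * √(A - f x) := by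
  refine le_of_forall_pos_le_add fun ε hε => ?_
  have hs := Real.sqrt_nonneg (A - f x)
  refine hf.hasFDerivAt.le_of_lip' (by positivity) ?_
  have hδ : 0 < ε / (K ^ 2 + 1) := by positivity
  filter_upwards [Metric.ball_mem_nhds x hδ] with y hy
  rw [Metric.mem_ball, dist_eq_norm, lt_div_iff₀ (by positivity)] at hy
  have h1 : f y - f x = (√(A - f x)) ^ 2 - (√(A - f y)) ^ 2 := by
    rw [Real.sq_sqrt (by linarith [hA x]), Real.sq_sqrt (by linarith [hA y])]; ring
  have h2 : (√(A - f x)) ^ 2 - (√(A - f y)) ^ 2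
      = -(√(A - f y) - √(A - f x)) * (√(A - f y) + √(A - f x)) := by ring
  have h3 : |√(A - f y) + √(A - f x)| ≤ 2 * √(A - f x) + K * ‖y - x‖ := by
    rw [abs_of_nonneg (by positivity)]
    linarith [le_abs_self (√(A - f y) - √(A - f x)), hL y]
  rw [Real.norm_eq_abs, h1, h2, abs_mul, abs_neg]
  calc _ ≤ (K * ‖y - x‖) * (2 * √(A - f x) + K * ‖y - x‖) := by gcongr; exact hL y
    _ = (2 * K * √(A - f x) + K ^ 2 * ‖y - x‖) * ‖y - x‖ := by ring
    _ ≤ _ := by gcongr; nlinarith [norm_nonneg (y - x)]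

/-- The integrand of the relative entropy of two densities, normalised to be nonnegative. -/
noncomputable def relEnt (a b : ℝ) : ℝ := a * (Real.log a - Real.log b) - a + b

/-- `relEnt` lies above linear functions, with equality at `l = a / b`; this expresses its joint
convexity. -/
lemma tangent_le_relEnt {a b l : ℝ} (ha : 0 < a) (hb : 0 < b) (hl : 0 < l) :
    a * Real.log l - l * b + b ≤ relEnt a b := by
  have h := Real.log_le_sub_one_of_pos (x := l * b / a) (by positivity)
  rw [Real.log_div (by positivity) ha.ne', Real.log_mul hl.ne' hb.ne'] at h
  have h2 := mul_le_mul_of_nonneg_left h ha.le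
  have h3 : a * (l * b / a - 1) = l * b - a := by field_simp
  unfold relEnt
  nlinarith

lemma relEnt_nonneg {a b : ℝ} (ha : 0 < a) (hb : 0 < b) : 0 ≤ relEnt a b := by
  have := tangent_le_relEnt ha hb one_pos
  simpa using this

lemma relEnt_le_sq {a b : ℝ} (ha : 0 < a) (hb : 0 < b) :
    relEnt a b ≤ (a + b) * (Real.log a - Real.log b) ^ 2 := by
  have key : ∀ x y : ℝ, 0 < x → 0 < y → x - y ≤ x * (Real.log x - Real.log y) := by
    intro x y hx hy
    have := relEnt_nonneg hx hy
    unfold relEnt at this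
    linarith
  -- the symmetrised relative entropy
  have h1 : relEnt a b ≤ (a - b) * (Real.log a - Real.log b) := by
    have := relEnt_nonneg hb ha
    unfold relEnt at this ⊢
    linarith
  refine h1.trans ?_
  have hab := key a b ha hb
  have hba := key b a hb ha
  rcases le_total b a with h | h
  · have := Real.log_le_log hb h
    have h2 := mul_le_mul_of_nonneg_right hab (sub_nonneg.2 this)
    nlinarith [mul_nonneg hb.le (sq_nonneg (Real.log a - Real.log b))]
  · have := Real.log_le_log ha h
    have h2 := mul_le_mul_of_nonneg_right hba (sub_nonneg.2 this)
    nlinarith [mul_nonneg ha.le (sq_nonneg (Real.log a - Real.log b))]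

namespace IsGaussianType

variable {d : ℕ} {k : Vec d → Vec d → ℝ} {A K D : ℝ}

lemma le_exp (hk : IsGaussianType k A K D) (x₀ x : Vec d) : k x₀ x ≤ Real.exp A := by
  rw [← Real.log_le_iff_le_exp (hk.pos _ _)]; exact hk.log_le _ _

lemma measurable_left (hk : IsGaussianType k A K D) (x : Vec d) :
    Measurable fun x₀ => k x₀ x := hk.measurable.comp (by fun_prop : Measurable fun x₀ => (x₀, x))

/-- The potential `ψ² = A - log k` is dominated by `1 / k`. -/
lemma sub_log_mul_le (hk : IsGaussianType k A K D) (x₀ x : Vec d) :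
    (A - Real.log (k x₀ x)) * k x₀ x ≤ Real.exp A := by
  have h := tangent_le_relEnt (hk.pos x₀ x) (Real.exp_pos A) one_pos
  simp only [Real.log_one, mul_zero, one_mul, relEnt, Real.log_exp] at h
  nlinarith [hk.pos x₀ x]

lemma norm_fderiv_le (hk : IsGaussianType k A K D) (x₀ x : Vec d) :
    ‖fderiv ℝ (k x₀) x‖ ≤ 2 * K * (√(A - Real.log (k x₀ x)) * k x₀ x) := by
  have h := norm_fderiv_le_of_sqrt_lipschitz (f := fun y => Real.log (k x₀ y)) (x := x) (A := A)
    hk.nonneg_K ((hk.differentiable x₀ x).log (hk.pos _ _).ne') (hk.log_le x₀)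
    (fun y => by simpa using hk.lipschitz x₀ y x₀ x)
  rw [fderiv.log (hk.differentiable x₀ x) (hk.pos _ _).ne', norm_smul, norm_inv, Real.norm_eq_abs,
    abs_of_pos (hk.pos _ _), inv_mul_le_iff₀ (hk.pos _ _)] at h
  linarith

lemma sqrt_mul_le (hk : IsGaussianType k A K D) (x₀ x : Vec d) :
    √(A - Real.log (k x₀ x)) * k x₀ x ≤ Real.exp A := by
  have h1 := Real.sq_sqrt (sub_nonneg.2 (hk.log_le x₀ x))
  have h2 := hk.sub_log_mul_le x₀ x
  have h3 := hk.le_exp x₀ x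
  have h4 := hk.pos x₀ x
  nlinarith [sq_nonneg (√(A - Real.log (k x₀ x)) - 1)]

section Mixture

variable (μ : Measure (Vec d)) [IsProbabilityMeasure μ]

lemma integrable (hk : IsGaussianType k A K D) (x : Vec d) : Integrable (fun x₀ => k x₀ x) μ :=
  Integrable.of_bound (hk.measurable_left x).aestronglyMeasurable (Real.exp A)
    (.of_forall fun x₀ => by
      rw [Real.norm_eq_abs, abs_of_pos (hk.pos _ _)]; exact hk.le_exp _ _)

lemma mix_pos (hk : IsGaussianType k A K D) (x : Vec d) : 0 < mix k μ x := by
  unfold mix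
  rw [integral_pos_iff_support_of_nonneg (fun x₀ => (hk.pos x₀ x).le) (hk.integrable μ x)]
  have : Function.support (fun x₀ => k x₀ x) = univ := by
    ext y; simp [(hk.pos y x).ne']
  simp [this]

lemma mix_le (hk : IsGaussianType k A K D) (x : Vec d) : mix k μ x ≤ Real.exp A := by
  calc mix k μ x ≤ ∫ _, Real.exp A ∂μ :=
        integral_mono (hk.integrable μ x) (integrable_const _) fun x₀ => hk.le_exp x₀ x
    _ = _ := by simp

lemma log_mix_le (hk : IsGaussianType k A K D) (x : Vec d) : Real.log (mix k μ x) ≤ A := by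
  rw [Real.log_le_iff_le_exp (hk.mix_pos μ x)]; exact hk.mix_le μ x

lemma measurable_mix (hk : IsGaussianType k A K D) : Measurable (mix k μ) := by
  have : StronglyMeasurable (Function.uncurry fun x x₀ => k x₀ x) :=
    (hk.measurable.comp measurable_swap).stronglyMeasurable
  exact this.integral_prod_right.measurable

lemma stronglyMeasurable_fderiv (hk : IsGaussianType k A K D) (x : Vec d) :
    StronglyMeasurable fun x₀ => fderiv ℝ (k x₀) x :=
  measurable_fderiv_param k (fun _ => x) (fun v => hk.measurable_left (x + v))
    fun x₀ => hk.differentiable x₀ x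

lemma hasFDerivAt_mix (hk : IsGaussianType k A K D) (x : Vec d) :
    HasFDerivAt (mix k μ) (∫ x₀, fderiv ℝ (k x₀) x ∂μ) x := by
  refine hasFDerivAt_integral_of_dominated_of_fderiv_le (F := fun x x₀ => k x₀ x)
    (F' := fun x x₀ => fderiv ℝ (k x₀) x) (s := univ) (bound := fun _ => 2 * K * Real.exp A)
    univ_mem (.of_forall fun y => (hk.measurable_left y).aestronglyMeasurable)
    (hk.integrable μ x) (hk.stronglyMeasurable_fderiv x).aestronglyMeasurable ?_
    (integrable_const _) ?_
  · refine .of_forall fun x₀ y _ => (hk.norm_fderiv_le x₀ y).trans ?_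
    have := hk.nonneg_K
    gcongr
    exact hk.sqrt_mul_le x₀ y
  · exact .of_forall fun x₀ y _ => (hk.differentiable x₀ y).hasFDerivAt

lemma differentiable_mix (hk : IsGaussianType k A K D) : Differentiable ℝ (mix k μ) :=
  fun x => (hk.hasFDerivAt_mix μ x).differentiableAt

lemma differentiable_log_mix (hk : IsGaussianType k A K D) :
    Differentiable ℝ fun x => Real.log (mix k μ x) :=
  fun x => (hk.differentiable_mix μ x).log (hk.mix_pos μ x).ne'

lemma integrable_sub_log_mul (hk : IsGaussianType k A K D) (x : Vec d) :
    Integrable (fun x₀ => (A - Real.log (k x₀ x)) * k x₀ x) μ := by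
  refine Integrable.of_bound ?_ (Real.exp A) (.of_forall fun x₀ => ?_)
  · have := hk.measurable_left x
    exact ((measurable_const.sub this.log).mul this).aestronglyMeasurable
  · rw [Real.norm_eq_abs, abs_of_nonneg]
    · exact hk.sub_log_mul_le _ _
    · exact mul_nonneg (sub_nonneg.2 (hk.log_le _ _)) (hk.pos _ _).le

/-- Jensen's inequality for `u ↦ u log u`: the posterior mean of `ψ²` is at most
`A - log (mix k μ x)`. -/
lemma integral_sub_log_mul_le (hk : IsGaussianType k A K D) (x : Vec d) :
    ∫ x₀, (A - Real.log (k x₀ x)) * k x₀ x ∂μ ≤ (A - Real.log (mix k μ x)) * mix k μ x := by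
  have hm := hk.mix_pos μ x
  have hi := hk.integrable μ x
  have hle : ∀ x₀, (A - Real.log (k x₀ x)) * k x₀ x
      ≤ (A - Real.log (mix k μ x) - 1) * k x₀ x + mix k μ x := fun x₀ => by
    have := relEnt_nonneg (hk.pos x₀ x) hm
    unfold relEnt at this
    linarith
  calc _ ≤ ∫ x₀, ((A - Real.log (mix k μ x) - 1) * k x₀ x + mix k μ x) ∂μ :=
        integral_mono (hk.integrable_sub_log_mul μ x)
          ((hi.const_mul _).add (integrable_const _)) hle
    _ = _ := by
        rw [integral_add (hi.const_mul _) (integrable_const _), integral_const_mul]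
        change _ * mix k μ x + _ = _
        simp
        ring

/-- The score of a mixture obeys the same bound `2 K √(A - log m)` as the scores of its
components. -/
lemma norm_fderiv_log_mix_le (hk : IsGaussianType k A K D) (x : Vec d) :
    ‖fderiv ℝ (fun y => Real.log (mix k μ y)) x‖ ≤ 2 * K * √(A - Real.log (mix k μ x)) := by
  have hm := hk.mix_pos μ x
  have hK := hk.nonneg_K
  have hψ0 := Real.sqrt_nonneg (A - Real.log (mix k μ x))
  rw [fderiv.log (hk.differentiable_mix μ x) hm.ne', norm_smul, norm_inv, Real.norm_eq_abs,
    abs_of_pos hm, inv_mul_le_iff₀ hm, (hk.hasFDerivAt_mix μ x).fderiv]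
  -- `2 ψ ≤ ψ² / s + s` for every `s` above the claimed bound, which avoids dividing by zero
  have key : ∀ s > √(A - Real.log (mix k μ x)),
      ‖∫ x₀, fderiv ℝ (k x₀) x ∂μ‖ ≤ mix k μ x * (2 * K * s) := by
    intro s hs
    have hs0 : 0 < s := hψ0.trans_lt hs
    have hi := (((hk.integrable_sub_log_mul μ x).const_mul (K / s)).add
      ((hk.integrable μ x).const_mul (K * s)))
    have hpt : ∀ x₀, ‖fderiv ℝ (k x₀) x‖
        ≤ K / s * ((A - Real.log (k x₀ x)) * k x₀ x) + K * s * k x₀ x := fun x₀ => by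
      refine (hk.norm_fderiv_le x₀ x).trans ?_
      have h1 := Real.sq_sqrt (sub_nonneg.2 (hk.log_le x₀ x))
      set ψ := √(A - Real.log (k x₀ x))
      have h2 : 2 * ψ ≤ ψ ^ 2 / s + s := by
        rw [← sub_nonneg]
        have : ψ ^ 2 / s + s - 2 * ψ = (ψ - s) ^ 2 / s := by field_simp; ring
        rw [this]; positivity
      have h3 := mul_le_mul_of_nonneg_left h2 (mul_nonneg hK (hk.pos x₀ x).le)
      rw [← h1]
      calc _ = K * k x₀ x * (2 * ψ) := by ring
        _ ≤ _ := h3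
        _ = _ := by ring
    calc _ ≤ ∫ x₀, (K / s * ((A - Real.log (k x₀ x)) * k x₀ x) + K * s * k x₀ x) ∂μ :=
          norm_integral_le_of_norm_le hi (.of_forall hpt)
      _ = K / s * (∫ x₀, (A - Real.log (k x₀ x)) * k x₀ x ∂μ) + K * s * mix k μ x := by
          rw [integral_add ((hk.integrable_sub_log_mul μ x).const_mul _)
            ((hk.integrable μ x).const_mul _), integral_const_mul, integral_const_mul]
          rfl
      _ ≤ K / s * (s ^ 2 * mix k μ x) + K * s * mix k μ x := by
          gcongr
          refine (hk.integral_sub_log_mul_le μ x).trans ?_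
          gcongr
          rw [← Real.sq_sqrt (sub_nonneg.2 (hk.log_mix_le μ x))]
          gcongr
      _ = _ := by field_simp; ring
  have hlim : Tendsto (fun s : ℝ => mix k μ x * (2 * K * s)) (𝓝[>] √(A - Real.log (mix k μ x)))
      (𝓝 (mix k μ x * (2 * K * √(A - Real.log (mix k μ x))))) :=
    Tendsto.mono_left (Continuous.tendsto (by fun_prop) _) nhdsWithin_le_nhds
  exact ge_of_tendsto hlim (by filter_upwards [self_mem_nhdsWithin] with s hs using key s hs)

/-- No moment of `μ` is needed: `k x₀ x ≥ exp (A - 2 ψ(x₀, 0)² - 2 K² ‖x‖²)`, and the integral of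
`exp (-2 ψ(x₀, 0)²)` is positive. -/
lemma exists_sub_log_mix_le (hk : IsGaussianType k A K D) :
    ∃ c, 0 ≤ c ∧ ∀ x, A - Real.log (mix k μ x) ≤ c + 2 * K ^ 2 * ‖x‖ ^ 2 := by
  set f : Vec d → ℝ := fun x₀ => Real.exp (-(2 * (A - Real.log (k x₀ 0)))) with hf
  have hfm : Measurable f :=
    ((measurable_const.sub (hk.measurable_left 0).log).const_mul 2).neg.exp
  have hf1 : ∀ x₀, f x₀ ≤ 1 := fun x₀ => by
    rw [hf, Real.exp_le_one_iff]; linarith [hk.log_le x₀ 0]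
  have hfi : Integrable f μ := Integrable.of_bound hfm.aestronglyMeasurable 1
    (.of_forall fun x₀ => by rw [Real.norm_eq_abs, abs_of_pos (Real.exp_pos _)]; exact hf1 x₀)
  have hpos : 0 < ∫ x₀, f x₀ ∂μ := by
    rw [integral_pos_iff_support_of_nonneg (fun x₀ => (Real.exp_pos _).le) hfi]
    have : Function.support f = univ := by ext y; simp [hf]
    change 0 < μ (Function.support f)
    simp [this]
  have hle1 : ∫ x₀, f x₀ ∂μ ≤ 1 := by
    calc _ ≤ ∫ _, (1 : ℝ) ∂μ := integral_mono hfi (integrable_const _) hf1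
      _ = 1 := by simp
  refine ⟨-Real.log (∫ x₀, f x₀ ∂μ), by
    linarith [Real.log_nonpos hpos.le hle1], fun x => ?_⟩
  have hlow : Real.exp (A - 2 * K ^ 2 * ‖x‖ ^ 2) * ∫ x₀, f x₀ ∂μ ≤ mix k μ x := by
    rw [← integral_const_mul]
    refine integral_mono (hfi.const_mul _) (hk.integrable μ x) fun x₀ => ?_
    rw [hf]
    simp only
    rw [← Real.exp_add, ← Real.le_log_iff_exp_le (hk.pos _ _)]
    have h1 := hk.lipschitz x₀ x x₀ 0
    simp only [sub_self, norm_zero, sub_zero, zero_add] at h1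
    have h2 := Real.sq_sqrt (sub_nonneg.2 (hk.log_le x₀ x))
    have h3 := Real.sq_sqrt (sub_nonneg.2 (hk.log_le x₀ 0))
    set a := √(A - Real.log (k x₀ x))
    set b := √(A - Real.log (k x₀ 0))
    have ha : 0 ≤ a := Real.sqrt_nonneg _
    have h4 : a ≤ b + K * ‖x‖ := by linarith [le_abs_self (a - b)]
    nlinarith [sq_nonneg (b - K * ‖x‖), mul_self_le_mul_self ha h4]
  have := Real.log_le_log (by positivity) hlow
  rw [Real.log_mul (Real.exp_pos _).ne' hpos.ne', Real.log_exp] at this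
  linarith

lemma exists_growth_log_mix (hk : IsGaussianType k A K D) :
    ∃ c, 0 ≤ c ∧ (∀ x, |Real.log (mix k μ x)| ≤ c * (1 + ‖x‖ ^ 2)) ∧
      ∀ x, ‖fderiv ℝ (fun y => Real.log (mix k μ y)) x‖ ≤ c * (1 + ‖x‖) := by
  obtain ⟨c, hc, h⟩ := hk.exists_sub_log_mix_le μ
  have hK := hk.nonneg_K
  have hlog : ∀ x, |Real.log (mix k μ x)| ≤ (|A| + c + 2 * K ^ 2) * (1 + ‖x‖ ^ 2) := fun x => by
    have h1 := h x
    have h2 := hk.log_mix_le μ x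
    have h3 : 0 ≤ (|A| + c) * ‖x‖ ^ 2 := by positivity
    rw [abs_le]
    constructor <;> nlinarith [le_abs_self A, neg_abs_le A, sq_nonneg K]
  have hgrad : ∀ x, ‖fderiv ℝ (fun y => Real.log (mix k μ y)) x‖
      ≤ 2 * K * (√c + 2 * K) * (1 + ‖x‖) := fun x => by
    refine (hk.norm_fderiv_log_mix_le μ x).trans ?_
    rw [mul_assoc (2 * K)]
    refine mul_le_mul_of_nonneg_left ?_ (by positivity)
    refine Real.sqrt_le_iff.2 ⟨by positivity, (h x).trans ?_⟩
    have h1 := Real.sq_sqrt hc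
    have h2 : 0 ≤ √c := Real.sqrt_nonneg c
    have h3 : (√c + 2 * K * ‖x‖) ≤ (√c + 2 * K) * (1 + ‖x‖) := by
      nlinarith [norm_nonneg x, mul_nonneg h2 (norm_nonneg x)]
    refine le_trans ?_ (pow_le_pow_left₀ (by positivity) h3 2)
    nlinarith [mul_nonneg (mul_nonneg h2 hK) (norm_nonneg x),
      mul_nonneg (sq_nonneg K) (sq_nonneg ‖x‖)]
  refine ⟨(|A| + c + 2 * K ^ 2) + 2 * K * (√c + 2 * K), by positivity, fun x => ?_, fun x => ?_⟩
  · refine (hlog x).trans ?_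
    refine mul_le_mul_of_nonneg_right ?_ (by positivity)
    linarith [show 0 ≤ 2 * K * (√c + 2 * K) by positivity]
  · refine (hgrad x).trans ?_
    refine mul_le_mul_of_nonneg_right ?_ (by positivity)
    linarith [show 0 ≤ |A| + c + 2 * K ^ 2 by positivity]

lemma ofReal_mix (hk : IsGaussianType k A K D) (x : Vec d) :
    ENNReal.ofReal (mix k μ x) = ∫⁻ x₀, ENNReal.ofReal (k x₀ x) ∂μ :=
  ofReal_integral_eq_lintegral_ofReal (hk.integrable μ x) (.of_forall fun x₀ => (hk.pos x₀ x).le)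

lemma lintegral_mul_mix (hk : IsGaussianType k A K D) {f : Vec d → ℝ≥0∞} (hf : Measurable f) :
    ∫⁻ x, f x * ENNReal.ofReal (mix k μ x) = ∫⁻ x₀, (∫⁻ x, f x * ENNReal.ofReal (k x₀ x)) ∂μ := by
  have hm : Measurable fun p : Vec d × Vec d => f p.2 * ENNReal.ofReal (k p.1 p.2) :=
    (hf.comp measurable_snd).mul hk.measurable.ennreal_ofReal
  rw [lintegral_lintegral_swap hm.aemeasurable]
  refine lintegral_congr fun x => ?_
  rw [hk.ofReal_mix μ, lintegral_const_mul _ (hk.measurable_left x).ennreal_ofReal]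

lemma lintegral_mix (hk : IsGaussianType k A K D) : ∫⁻ x, ENNReal.ofReal (mix k μ x) = 1 := by
  have := hk.lintegral_mul_mix μ (f := fun _ => 1) measurable_const
  simpa [hk.lintegral_eq_one] using this

lemma integrable_mix (hk : IsGaussianType k A K D) : Integrable (mix k μ) := by
  refine ⟨(hk.measurable_mix μ).aestronglyMeasurable, ?_⟩
  rw [hasFiniteIntegral_iff_ofReal (.of_forall fun x => (hk.mix_pos μ x).le), hk.lintegral_mix μ]
  exact ENNReal.one_lt_top

lemma integral_mix (hk : IsGaussianType k A K D) : ∫ x, mix k μ x = 1 := by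
  rw [integral_eq_lintegral_of_nonneg_ae (.of_forall fun x => (hk.mix_pos μ x).le)
    (hk.measurable_mix μ).aestronglyMeasurable, hk.lintegral_mix μ]
  rfl

end Mixture

/-! ### Relative entropy of two mixtures -/

/-- The factor `‖u - v‖²` makes the relative entropy second order, and the remaining one has a
bounded integral. For `K ‖u - v‖ > 1` the quadratic bound on `relEnt` would be of fourth order;
there the crude bound `log (k u / k v)` is already good enough. -/
lemma relEnt_le (hk : IsGaussianType k A K D) (u v x : Vec d) :
    relEnt (k u x) (k v x) ≤ (K * ‖u - v‖) ^ 2 *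
      (k u x * (8 * (A - Real.log (k u x)) + 2) + k v x * (8 * (A - Real.log (k v x)) + 2)) := by
  have hku := hk.pos u x
  have hkv := hk.pos v x
  have hK : 0 ≤ K * ‖u - v‖ := mul_nonneg hk.nonneg_K (norm_nonneg _)
  have h := hk.lipschitz u x v x
  simp only [sub_self, norm_zero, add_zero] at h
  have hb := Real.sq_sqrt (sub_nonneg.2 (hk.log_le u x))
  have ha := Real.sq_sqrt (sub_nonneg.2 (hk.log_le v x))
  have hs : Real.log (k u x) - Real.log (k v x)
      = (√(A - Real.log (k v x)) - √(A - Real.log (k u x))) *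
        (√(A - Real.log (k v x)) + √(A - Real.log (k u x))) := by
    linear_combination hb - ha
  rw [← hb, ← ha]
  have h0b : 0 ≤ √(A - Real.log (k u x)) := Real.sqrt_nonneg _
  have h0a : 0 ≤ √(A - Real.log (k v x)) := Real.sqrt_nonneg _
  set b := √(A - Real.log (k u x))
  set a := √(A - Real.log (k v x))
  set κ := K * ‖u - v‖
  rw [abs_le] at h
  have hb2 : (2 * b + 1) ^ 2 ≤ 8 * b ^ 2 + 2 := by nlinarith [sq_nonneg (2 * b - 1)]
  have ha2 : (2 * a + 1) ^ 2 ≤ 8 * a ^ 2 + 2 := by nlinarith [sq_nonneg (2 * a - 1)]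
  rcases le_total κ 1 with h1 | h1
  · have hab : (a + b) ^ 2 ≤ 8 * b ^ 2 + 2 :=
      (pow_le_pow_left₀ (by positivity) (by linarith) 2).trans hb2
    have hba : (a + b) ^ 2 ≤ 8 * a ^ 2 + 2 :=
      (pow_le_pow_left₀ (by positivity) (by linarith) 2).trans ha2
    have hd : (a - b) ^ 2 ≤ κ ^ 2 := sq_le_sq' (by linarith) (by linarith)
    calc _ ≤ (k u x + k v x) * (Real.log (k u x) - Real.log (k v x)) ^ 2 := relEnt_le_sq hku hkv
      _ = (a - b) ^ 2 * (k u x * (a + b) ^ 2 + k v x * (a + b) ^ 2) := by rw [hs]; ring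
      _ ≤ _ := by gcongr
  · have hκ : κ ≤ κ ^ 2 := by nlinarith
    have h3 : (a - b) * (a + b) ≤ κ ^ 2 * (8 * b ^ 2 + 2) := by
      calc (a - b) * (a + b) ≤ κ * (a + b) := by gcongr; linarith
        _ ≤ κ * (κ * (2 * b + 1)) := by gcongr; nlinarith
        _ = κ ^ 2 * (2 * b + 1) := by ring
        _ ≤ _ := by
          refine mul_le_mul_of_nonneg_left ?_ (by positivity)
          nlinarith [sq_nonneg (2 * b - 1)]
    have h4 : 1 ≤ κ ^ 2 * (8 * a ^ 2 + 2) := by nlinarith [sq_nonneg a, sq_nonneg (κ * a)]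
    unfold relEnt
    rw [hs]
    nlinarith [mul_le_mul_of_nonneg_left h3 hku.le, mul_le_mul_of_nonneg_left h4 hkv.le]

lemma lintegral_affine_le (hk : IsGaussianType k A K D) (u : Vec d) :
    ∫⁻ x, ENNReal.ofReal (k u x * (8 * (A - Real.log (k u x)) + 2))
      ≤ ENNReal.ofReal (8 * D + 2) := by
  have hm : Measurable (k u) := hk.measurable.comp (by fun_prop : Measurable fun x => (u, x))
  have : ∀ x, ENNReal.ofReal (k u x * (8 * (A - Real.log (k u x)) + 2))
      = ENNReal.ofReal 8 * ENNReal.ofReal ((A - Real.log (k u x)) * k u x)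
        + ENNReal.ofReal 2 * ENNReal.ofReal (k u x) := fun x => by
    have h1 := sub_nonneg.2 (hk.log_le u x)
    have h2 := (hk.pos u x).le
    rw [← ENNReal.ofReal_mul (by norm_num), ← ENNReal.ofReal_mul (by norm_num),
      ← ENNReal.ofReal_add (by positivity) (by positivity)]
    congr 1
    ring
  simp_rw [this]
  rw [lintegral_add_right _ (by fun_prop), lintegral_const_mul _ (by fun_prop),
    lintegral_const_mul _ (by fun_prop), hk.lintegral_eq_one]
  have hD := hk.nonneg_D
  rw [ENNReal.ofReal_add (by positivity) (by norm_num), ENNReal.ofReal_mul (by norm_num), mul_one]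
  gcongr
  exact hk.lintegral_le u

/-- The relative entropy of the mixtures over the laws of `u` and `v` is of second order in the
coupling distance: by joint convexity it is at most the mean relative entropy of the kernels. -/
lemma lintegral_relEnt_mix_le (hk : IsGaussianType k A K D) {Z : Type*} [MeasurableSpace Z]
    (P : Measure Z) [IsProbabilityMeasure P] {u v : Z → Vec d} (hu : Measurable u)
    (hv : Measurable v) (huv : MemLp (fun z => u z - v z) 2 P) :
    ∫⁻ x, ENNReal.ofReal (relEnt (mix k (P.map u) x) (mix k (P.map v) x))
      ≤ ENNReal.ofReal (2 * (8 * D + 2) * K ^ 2 * ∫ z, ‖u z - v z‖ ^ 2 ∂P) := by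
  have : IsProbabilityMeasure (P.map u) := Measure.isProbabilityMeasure_map hu.aemeasurable
  have : IsProbabilityMeasure (P.map v) := Measure.isProbabilityMeasure_map hv.aemeasurable
  have hsq : Integrable (fun z => ‖u z - v z‖ ^ 2) P := huv.integrable_norm_pow two_ne_zero
  set B : Z → Vec d → ℝ := fun z x => k (u z) x * (8 * (A - Real.log (k (u z) x)) + 2)
    + k (v z) x * (8 * (A - Real.log (k (v z) x)) + 2) with hB
  have hB0 : ∀ z x, 0 ≤ B z x := fun z x => by
    have h1 := sub_nonneg.2 (hk.log_le (u z) x)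
    have h2 := (hk.pos (u z) x).le
    have h3 := sub_nonneg.2 (hk.log_le (v z) x)
    have h4 := (hk.pos (v z) x).le
    simp only [hB]; positivity
  have hBle : ∀ z x, B z x ≤ 20 * Real.exp A := fun z x => by
    have h1 := hk.sub_log_mul_le (u z) x
    have h2 := hk.le_exp (u z) x
    have h3 := hk.sub_log_mul_le (v z) x
    have h4 := hk.le_exp (v z) x
    simp only [hB]; nlinarith
  have hmu : Measurable fun p : Z × Vec d => k (u p.1) p.2 :=
    hk.measurable.comp ((hu.comp measurable_fst).prodMk measurable_snd)
  have hmv : Measurable fun p : Z × Vec d => k (v p.1) p.2 :=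
    hk.measurable.comp ((hv.comp measurable_fst).prodMk measurable_snd)
  have hBm : Measurable fun p : Z × Vec d => B p.1 p.2 := by
    simp only [hB]
    exact (hmu.mul (((measurable_const.sub hmu.log).const_mul 8).add_const 2)).add
      (hmv.mul (((measurable_const.sub hmv.log).const_mul 8).add_const 2))
  have hint : ∀ x, Integrable (fun z => (K * ‖u z - v z‖) ^ 2 * B z x) P := fun x => by
    refine Integrable.mono' (g := fun z => (20 * Real.exp A * K ^ 2) * ‖u z - v z‖ ^ 2)
      (hsq.const_mul _) ?_ (.of_forall fun z => ?_)
    · have : Measurable fun z => B z x := hBm.comp (by fun_prop : Measurable fun z => (z, x))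
      exact ((((hu.sub hv).norm.const_mul K).pow_const 2).mul this).aestronglyMeasurable
    · rw [Real.norm_eq_abs, abs_of_nonneg (mul_nonneg (sq_nonneg _) (hB0 z x))]
      nlinarith [mul_le_mul_of_nonneg_left (hBle z x) (sq_nonneg (K * ‖u z - v z‖))]
  have hpt : ∀ x, relEnt (mix k (P.map u) x) (mix k (P.map v) x)
      ≤ ∫ z, (K * ‖u z - v z‖) ^ 2 * B z x ∂P := fun x => by
    have hp := hk.mix_pos (P.map u) x
    have hq := hk.mix_pos (P.map v) x
    have hiu : Integrable (fun z => k (u z) x) P :=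
      (integrable_map_measure (hk.measurable_left x).aestronglyMeasurable hu.aemeasurable).1
        (hk.integrable (P.map u) x)
    have hiv : Integrable (fun z => k (v z) x) P :=
      (integrable_map_measure (hk.measurable_left x).aestronglyMeasurable hv.aemeasurable).1
        (hk.integrable (P.map v) x)
    have hmixu : mix k (P.map u) x = ∫ z, k (u z) x ∂P :=
      integral_map hu.aemeasurable (hk.measurable_left x).aestronglyMeasurable
    have hmixv : mix k (P.map v) x = ∫ z, k (v z) x ∂P :=
      integral_map hv.aemeasurable (hk.measurable_left x).aestronglyMeasurable
    -- the supporting hyperplane of `relEnt` at the two mixture values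
    set l := mix k (P.map u) x / mix k (P.map v) x with hl
    have hl0 : 0 < l := div_pos hp hq
    have hi2 := ((hiu.mul_const (Real.log l)).sub (hiv.const_mul l)).add hiv
    have hle := integral_mono hi2 (hint x) fun z =>
      (tangent_le_relEnt (hk.pos (u z) x) (hk.pos (v z) x) hl0).trans (hk.relEnt_le (u z) (v z) x)
    refine le_trans (le_of_eq ?_) hle
    have : ∫ z, (k (u z) x * Real.log l - l * k (v z) x + k (v z) x) ∂P
        = mix k (P.map u) x * Real.log l - l * mix k (P.map v) x + mix k (P.map v) x := by
      rw [integral_add (f := fun z => k (u z) x * Real.log l - l * k (v z) x)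
          ((hiu.mul_const _).sub (hiv.const_mul _)) hiv,
        integral_sub (hiu.mul_const _) (hiv.const_mul _), integral_mul_const, integral_const_mul,
        hmixu, hmixv]
    refine Eq.trans ?_ this.symm
    rw [hl, Real.log_div hp.ne' hq.ne', div_mul_cancel₀ _ hq.ne']
    rfl
  have hD := hk.nonneg_D
  have hm1 : ∀ w : Vec d, Measurable (k w) := fun w =>
    hk.measurable.comp (by fun_prop : Measurable fun x => (w, x))
  calc _ ≤ ∫⁻ x, ∫⁻ z, ENNReal.ofReal ((K * ‖u z - v z‖) ^ 2 * B z x) ∂P := by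
        refine lintegral_mono fun x => ?_
        rw [← ofReal_integral_eq_lintegral_ofReal (hint x)
          (.of_forall fun z => mul_nonneg (sq_nonneg _) (hB0 z x))]
        exact ENNReal.ofReal_le_ofReal (hpt x)
    _ = ∫⁻ z, (∫⁻ x, ENNReal.ofReal ((K * ‖u z - v z‖) ^ 2 * B z x)) ∂P := by
        refine lintegral_lintegral_swap (Measurable.aemeasurable ?_)
        exact (((((hu.sub hv).norm.const_mul K).pow_const 2).comp measurable_snd).mul
          (hBm.comp measurable_swap)).ennreal_ofReal
    _ ≤ ∫⁻ z, ENNReal.ofReal (2 * (8 * D + 2) * K ^ 2 * ‖u z - v z‖ ^ 2) ∂P := by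
        refine lintegral_mono fun z => ?_
        simp_rw [ENNReal.ofReal_mul (sq_nonneg (K * ‖u z - v z‖))]
        have hBz : Measurable fun x => B z x :=
          hBm.comp (by fun_prop : Measurable fun x => (z, x))
        rw [lintegral_const_mul _ hBz.ennreal_ofReal]
        have hsplit : ∀ x, ENNReal.ofReal (B z x)
            = ENNReal.ofReal (k (u z) x * (8 * (A - Real.log (k (u z) x)) + 2))
              + ENNReal.ofReal (k (v z) x * (8 * (A - Real.log (k (v z) x)) + 2)) := fun x => by
          have h1 := sub_nonneg.2 (hk.log_le (u z) x)
          have h2 := (hk.pos (u z) x).le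
          have h3 := sub_nonneg.2 (hk.log_le (v z) x)
          have h4 := (hk.pos (v z) x).le
          rw [← ENNReal.ofReal_add (by positivity) (by positivity)]
        simp_rw [hsplit]
        have hmuz := hm1 (u z)
        rw [lintegral_add_left (by fun_prop)]
        calc _ ≤ ENNReal.ofReal ((K * ‖u z - v z‖) ^ 2) *
              (ENNReal.ofReal (8 * D + 2) + ENNReal.ofReal (8 * D + 2)) := by
              gcongr <;> exact hk.lintegral_affine_le _
          _ = _ := by
              rw [← ENNReal.ofReal_add (by positivity) (by positivity),
                ← ENNReal.ofReal_mul (by positivity)]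
              congr 1
              ring
    _ = _ := by
        rw [← ofReal_integral_eq_lintegral_ofReal (hsq.const_mul _)
          (.of_forall fun z => by positivity), integral_const_mul]

end IsGaussianType

/-! ### Expectations along a differentiable random path -/

section Path

variable {d : ℕ} {Ω : Type*} [MeasurableSpace Ω] {P : Measure Ω}

lemma integrable_comp_of_quadratic_growth [IsProbabilityMeasure P] {X : Ω → Vec d}
    (hXm : Measurable X) (hX : MemLp X 2 P) {f : Vec d → ℝ} (hf : Measurable f) {c : ℝ}
    (hc : ∀ x, |f x| ≤ c * (1 + ‖x‖ ^ 2)) : Integrable (fun ω => f (X ω)) P :=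
  (((integrable_const (1 : ℝ)).add (hX.integrable_norm_pow two_ne_zero)).const_mul c).mono'
    (hf.comp hXm).aestronglyMeasurable (.of_forall fun ω => hc (X ω))

variable {V : Type*} [NormedAddCommGroup V] [NormedSpace ℝ V]
  {X : V → Ω → Vec d} {H : Ω → ℝ} {θ₀ : V} {ε : ℝ}

lemma norm_path_sub_le {E : Type*} [NormedAddCommGroup E] [NormedSpace ℝ E] {f : V → E}
    (hf : Differentiable ℝ f) {C : ℝ} (hC : ∀ θ ∈ Metric.ball θ₀ ε, ‖fderiv ℝ f θ‖ ≤ C)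
    {θ₁ θ₂ : V} (h₁ : θ₁ ∈ Metric.ball θ₀ ε) (h₂ : θ₂ ∈ Metric.ball θ₀ ε) :
    ‖f θ₂ - f θ₁‖ ≤ C * ‖θ₂ - θ₁‖ :=
  (convex_ball θ₀ ε).norm_image_sub_le_of_norm_fderiv_le (fun θ _ => hf θ) hC h₁ h₂

/-- Square integrability is inherited along a path with square integrable derivative bound. -/
lemma memLp_path (hXm : ∀ θ, Measurable (X θ))
    (hXd : ∀ ω, Differentiable ℝ fun θ => X θ ω)
    (hH : MemLp H 2 P)
    (hXH : ∀ᵐ ω ∂P, ∀ θ ∈ Metric.ball θ₀ ε, ‖fderiv ℝ (fun θ' => X θ' ω) θ‖ ≤ H ω)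
    {θ₁ θ₂ : V} (h₁ : θ₁ ∈ Metric.ball θ₀ ε) (h₂ : θ₂ ∈ Metric.ball θ₀ ε) :
    MemLp (fun ω => X θ₂ ω - X θ₁ ω) 2 P := by
  refine (hH.mul_const ‖θ₂ - θ₁‖).mono' ((hXm θ₂).sub (hXm θ₁)).aestronglyMeasurable ?_
  filter_upwards [hXH] with ω hω using norm_path_sub_le (hXd ω) hω h₁ h₂

lemma hasFDerivAt_integral_comp_path [IsProbabilityMeasure P] [FiniteDimensional ℝ V]
    (hε : 0 < ε) (hXm : ∀ θ, Measurable (X θ))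
    (hXd : ∀ ω, Differentiable ℝ fun θ => X θ ω) (hX : MemLp (X θ₀) 2 P) (hH : MemLp H 2 P)
    (hXH : ∀ᵐ ω ∂P, ∀ θ ∈ Metric.ball θ₀ ε, ‖fderiv ℝ (fun θ' => X θ' ω) θ‖ ≤ H ω)
    {h : Vec d → ℝ} (hh : Differentiable ℝ h) {c : ℝ} (hc0 : 0 ≤ c)
    (hc : ∀ x, |h x| ≤ c * (1 + ‖x‖ ^ 2)) (hc' : ∀ x, ‖fderiv ℝ h x‖ ≤ c * (1 + ‖x‖)) :
    HasFDerivAt (fun θ => ∫ ω, h (X θ ω) ∂P)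
      (∫ ω, (fderiv ℝ h (X θ₀ ω)).comp (fderiv ℝ (fun θ => X θ ω) θ₀) ∂P) θ₀ := by
  have hθ₀ : θ₀ ∈ Metric.ball θ₀ ε := Metric.mem_ball_self hε
  have hhm : Measurable h := hh.continuous.measurable
  have hmeas : StronglyMeasurable fun ω => fderiv ℝ (fun θ => X θ ω) θ₀ :=
    measurable_fderiv_param (fun ω θ => X θ ω) (fun _ => θ₀) (fun v => hXm _) fun ω => hXd ω θ₀
  have hmeas' : StronglyMeasurable fun ω => fderiv ℝ h (X θ₀ ω) :=
    ((measurable_fderiv ℝ h).comp (hXm θ₀)).stronglyMeasurable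
  refine hasFDerivAt_integral_of_dominated_of_fderiv_le (F := fun θ ω => h (X θ ω))
    (F' := fun θ ω => (fderiv ℝ h (X θ ω)).comp (fderiv ℝ (fun θ => X θ ω) θ))
    (bound := fun ω => c * (((1 + ‖X θ₀ ω‖) + ε * H ω) * H ω))
    (Metric.ball_mem_nhds θ₀ hε)
    (.of_forall fun θ => (hhm.comp (hXm θ)).aestronglyMeasurable)
    (integrable_comp_of_quadratic_growth (hXm θ₀) hX hhm hc) ?_ ?_ ?_ ?_
  · exact (isBoundedBilinearMap_comp.continuous.comp_stronglyMeasurable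
      (hmeas'.prodMk hmeas)).aestronglyMeasurable
  · filter_upwards [hXH] with ω hω θ hθ
    have hH0 : 0 ≤ H ω := (norm_nonneg _).trans (hω θ hθ)
    have h1 : ‖X θ ω‖ ≤ ‖X θ₀ ω‖ + ε * H ω := by
      have h2 := norm_path_sub_le (hXd ω) hω hθ₀ hθ
      rw [Metric.mem_ball, dist_eq_norm] at hθ
      have h3 := norm_le_norm_add_norm_sub' (X θ ω) (X θ₀ ω)
      nlinarith
    calc _ ≤ ‖fderiv ℝ h (X θ ω)‖ * ‖fderiv ℝ (fun θ => X θ ω) θ‖ :=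
          ContinuousLinearMap.opNorm_comp_le _ _
      _ ≤ (c * (1 + ‖X θ ω‖)) * H ω := by gcongr; exacts [hc' _, hω θ hθ]
      _ ≤ (c * (1 + (‖X θ₀ ω‖ + ε * H ω))) * H ω := by gcongr
      _ = _ := by ring
  · have h1 : MemLp (fun ω => (1 + ‖X θ₀ ω‖) + ε * H ω) 2 P :=
      ((memLp_const (1 : ℝ)).add hX.norm).add (hH.const_mul ε)
    have h2 : Integrable (fun ω => (1 + ‖X θ₀ ω‖ + ε * H ω) * H ω) P := h1.integrable_mul hH
    exact h2.const_mul c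
  · exact .of_forall fun ω θ _ =>
      HasFDerivAt.comp θ (hh _).hasFDerivAt (hXd ω θ).hasFDerivAt

end Path

/-! ### Kullback-Leibler divergence of two positive densities -/

section KL

variable {E : Type*} [MeasurableSpace E] {m : Measure E} {p r : E → ℝ}

lemma withDensity_ratio (hp : Measurable p) (hr : Measurable r) (hr0 : ∀ x, 0 < r x) :
    m.withDensity (fun x => ENNReal.ofReal (p x))
      = (m.withDensity fun x => ENNReal.ofReal (r x)).withDensity
          fun x => ENNReal.ofReal (p x / r x) := by
  have hpr : Measurable fun x => p x / r x := hp.div hr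
  rw [← withDensity_mul _ hr.ennreal_ofReal hpr.ennreal_ofReal]
  congr 1
  funext x
  rw [Pi.mul_apply, ← ENNReal.ofReal_mul (hr0 x).le, mul_div_cancel₀ _ (hr0 x).ne']

lemma rnDeriv_withDensity_ratio [SigmaFinite m] (hp : Measurable p) (hr : Measurable r)
    (hr0 : ∀ x, 0 < r x) :
    (m.withDensity fun x => ENNReal.ofReal (p x)).rnDeriv
        (m.withDensity fun x => ENNReal.ofReal (r x))
      =ᵐ[m.withDensity fun x => ENNReal.ofReal (r x)] fun x => ENNReal.ofReal (p x / r x) := by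
  have : SigmaFinite (m.withDensity fun x => ENNReal.ofReal (r x)) :=
    SigmaFinite.withDensity_ofReal r
  rw [withDensity_ratio hp hr hr0]
  exact Measure.rnDeriv_withDensity _ (hp.div hr).ennreal_ofReal

lemma withDensity_absolutelyContinuous_of_pos (hp : Measurable p) (hr : Measurable r)
    (hr0 : ∀ x, 0 < r x) :
    m.withDensity (fun x => ENNReal.ofReal (p x))
      ≪ m.withDensity fun x => ENNReal.ofReal (r x) := by
  rw [withDensity_ratio hp hr hr0]
  exact withDensity_absolutelyContinuous _ _

lemma klDiv_withDensity_eq_lintegral [SigmaFinite m] (hp : Measurable p) (hr : Measurable r)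
    (hp0 : ∀ x, 0 < p x) (hr0 : ∀ x, 0 < r x)
    [IsFiniteMeasure (m.withDensity fun x => ENNReal.ofReal (p x))]
    [IsFiniteMeasure (m.withDensity fun x => ENNReal.ofReal (r x))] :
    klDiv (m.withDensity fun x => ENNReal.ofReal (p x))
        (m.withDensity fun x => ENNReal.ofReal (r x))
      = ∫⁻ x, ENNReal.ofReal (r x) * ENNReal.ofReal (klFun (p x / r x)) ∂m := by
  rw [klDiv_eq_lintegral_klFun_of_ac (withDensity_absolutelyContinuous_of_pos hp hr hr0)]
  have h1 : ∫⁻ x, ENNReal.ofReal (klFun (((m.withDensity fun x => ENNReal.ofReal (p x)).rnDeriv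
        (m.withDensity fun x => ENNReal.ofReal (r x)) x).toReal))
          ∂(m.withDensity fun x => ENNReal.ofReal (r x))
      = ∫⁻ x, ENNReal.ofReal (klFun (p x / r x))
          ∂(m.withDensity fun x => ENNReal.ofReal (r x)) := by
    refine lintegral_congr_ae ?_
    filter_upwards [rnDeriv_withDensity_ratio hp hr hr0] with x hx
    rw [hx, ENNReal.toReal_ofReal (div_pos (hp0 x) (hr0 x)).le]
  rw [h1]
  exact lintegral_withDensity_eq_lintegral_mul m hr.ennreal_ofReal
    (measurable_klFun.comp (hp.div hr)).ennreal_ofReal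

lemma toReal_klDiv_withDensity [SigmaFinite m] (hp : Measurable p) (hr : Measurable r)
    (hp0 : ∀ x, 0 < p x) (hr0 : ∀ x, 0 < r x)
    [IsProbabilityMeasure (m.withDensity fun x => ENNReal.ofReal (p x))]
    [IsProbabilityMeasure (m.withDensity fun x => ENNReal.ofReal (r x))] :
    (klDiv (m.withDensity fun x => ENNReal.ofReal (p x))
        (m.withDensity fun x => ENNReal.ofReal (r x))).toReal
      = ∫ x, (Real.log (p x) - Real.log (r x)) ∂(m.withDensity fun x => ENNReal.ofReal (p x)) := by
  have hac := withDensity_absolutelyContinuous_of_pos (m := m) hp hr hr0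
  rw [toReal_klDiv_of_measure_eq hac (by simp)]
  refine integral_congr_ae ?_
  filter_upwards [hac.ae_le (rnDeriv_withDensity_ratio (m := m) hp hr hr0)] with x hx
  rw [llr, hx, ENNReal.toReal_ofReal (div_pos (hp0 x) (hr0 x)).le,
    Real.log_div (hp0 x).ne' (hr0 x).ne']

end KL

lemma measurable_gradient {d : ℕ} (f : Vec d → ℝ) : Measurable (gradient f) :=
  (InnerProductSpace.toDual ℝ (Vec d)).symm.continuous.measurable.comp (measurable_fderiv ℝ f)

lemma stronglyMeasurable_vjp {α : Type*} [MeasurableSpace α] {d k : ℕ} {X : Vec k → α → Vec d}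
    (hXm : ∀ θ, Measurable (X θ)) (hXd : ∀ a, Differentiable ℝ fun θ => X θ a) {s : α → Vec d}
    (hs : Measurable s) {θ₀ : Vec k} : StronglyMeasurable fun a =>
      ContinuousLinearMap.adjoint (fderiv ℝ (fun θ => X θ a) θ₀) (s a) := by
  have h : StronglyMeasurable fun a => fderiv ℝ (fun θ => X θ a) θ₀ :=
    measurable_fderiv_param (fun a θ => X θ a) (fun _ => θ₀) (fun v => hXm _) fun a => hXd a θ₀
  have h' := (ContinuousLinearMap.adjoint (𝕜 := ℝ) (E := Vec k)
    (F := Vec d)).continuous.comp_stronglyMeasurable h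
  exact isBoundedBilinearMap_apply.continuous.comp_stronglyMeasurable
    (h'.prodMk hs.stronglyMeasurable)

/-! ### The noised generator at a fixed prompt and noise level -/

/-- A reparametrized sampler of the kernel `k`: a random Lipschitz map `Φ · ω` such that `Φ x₀ ω`
has density `k x₀` for every `x₀`. -/
structure IsSampler {d : ℕ} {W : Type*} [MeasurableSpace W] (ν : Measure W)
    (k : Vec d → Vec d → ℝ) (Φ : Vec d → W → Vec d) (L : ℝ) : Prop where
  measurable : Measurable (Function.uncurry Φ)
  law : ∀ x₀, ν.map (Φ x₀) = volume.withDensity fun x => ENNReal.ofReal (k x₀ x)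
  differentiable : ∀ ω, Differentiable ℝ fun x₀ => Φ x₀ ω
  norm_fderiv_le : ∀ ω x₀, ‖fderiv ℝ (fun y => Φ y ω) x₀‖ ≤ L
  memLp : MemLp (Φ 0) 2 ν

/-- A random map `G θ : Z → Vec d`, differentiable in the parameter `θ` and square integrable, whose
derivative on the ball of radius `ε` about `θ₀` is dominated by the square integrable `B`. -/
structure IsRegularGenerator {d k : ℕ} {Z : Type*} [MeasurableSpace Z] (pz : Measure Z)
    (G : Vec k → Z → Vec d) (θ₀ : Vec k) (ε : ℝ) (B : Z → ℝ) : Prop where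
  measurable : ∀ θ, Measurable (G θ)
  differentiable : ∀ z, Differentiable ℝ fun θ => G θ z
  memLp : MemLp (G θ₀) 2 pz
  pos : 0 < ε
  memLp_bound : MemLp B 2 pz
  norm_fderiv_le : ∀ᵐ z ∂pz, ∀ θ ∈ Metric.ball θ₀ ε, ‖fderiv ℝ (fun θ' => G θ' z) θ‖ ≤ B z

lemma IsRegularGenerator.exists_of_mem_ball {d k : ℕ} {Z : Type*} [MeasurableSpace Z]
    {pz : Measure Z} {G : Vec k → Z → Vec d} {θ₀ θ : Vec k} {ε : ℝ} {B : Z → ℝ}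
    (hG : IsRegularGenerator pz G θ₀ ε B) (hθ : θ ∈ Metric.ball θ₀ ε) :
    ∃ ε', IsRegularGenerator pz G θ ε' B := by
  obtain ⟨ε', hε', hsub⟩ := Metric.isOpen_iff.1 Metric.isOpen_ball θ hθ
  refine ⟨ε', hG.measurable, hG.differentiable, ?_, hε', hG.memLp_bound, ?_⟩
  · have h := (memLp_path hG.measurable hG.differentiable hG.memLp_bound hG.norm_fderiv_le
      (Metric.mem_ball_self hG.pos) hθ).add hG.memLp
    exact h.ae_eq (.of_forall fun z => by simp)
  · filter_upwards [hG.norm_fderiv_le] with z hz θ' hθ' using hz θ' (hsub hθ')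

section Sampler

variable {d : ℕ} {kr : Vec d → Vec d → ℝ} {A K D L : ℝ}
  {W : Type*} [MeasurableSpace W] {ν : Measure W}
  {Φ : Vec d → W → Vec d} {Z : Type*} [MeasurableSpace Z] {pz : Measure Z}

lemma IsGaussianType.isProbabilityMeasure_mix (hk : IsGaussianType kr A K D) (μ : Measure (Vec d))
    [IsProbabilityMeasure μ] :
    IsProbabilityMeasure (volume.withDensity fun x => ENNReal.ofReal (mix kr μ x)) :=
  ⟨by rw [withDensity_apply _ .univ, setLIntegral_univ, hk.lintegral_mix μ]⟩

lemma IsSampler.measurable_comp (hΦ : IsSampler ν kr Φ L) {u : Z → Vec d} (hu : Measurable u) :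
    Measurable fun p : Z × W => Φ (u p.1) p.2 :=
  hΦ.measurable.comp ((hu.comp measurable_fst).prodMk measurable_snd)

lemma IsSampler.lipschitz (hΦ : IsSampler ν kr Φ L) (ω : W) (x y : Vec d) :
    ‖Φ x ω - Φ y ω‖ ≤ L * ‖x - y‖ :=
  convex_univ.norm_image_sub_le_of_norm_fderiv_le (fun x _ => hΦ.differentiable ω x)
    (fun x _ => hΦ.norm_fderiv_le ω x) (mem_univ _) (mem_univ _)

lemma IsSampler.memLp_comp [IsProbabilityMeasure ν] [IsProbabilityMeasure pz]
    (hΦ : IsSampler ν kr Φ L) {u : Z → Vec d} (hu : Measurable u)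
    (hu2 : MemLp u 2 pz) : MemLp (fun p : Z × W => Φ (u p.1) p.2) 2 (pz.prod ν) := by
  have h1 : MemLp (fun p : Z × W => ‖Φ 0 p.2‖) 2 (pz.prod ν) :=
    (hΦ.memLp.norm).comp_measurePreserving measurePreserving_snd
  have h2 : MemLp (fun p : Z × W => ‖u p.1‖) 2 (pz.prod ν) :=
    (hu2.norm).comp_measurePreserving measurePreserving_fst
  refine (h1.add (h2.const_mul L)).mono' (hΦ.measurable_comp hu).aestronglyMeasurable
    (.of_forall fun p => ?_)
  have h3 := hΦ.lipschitz p.2 (u p.1) 0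
  rw [sub_zero] at h3
  have h4 := norm_le_norm_add_norm_sub' (Φ (u p.1) p.2) (Φ 0 p.2)
  simp only [Pi.add_apply]
  linarith

/-- Noising the law of `u` gives the mixture of the kernel over that law. -/
lemma IsSampler.map_comp [IsProbabilityMeasure ν] [IsProbabilityMeasure pz]
    (hk : IsGaussianType kr A K D) (hΦ : IsSampler ν kr Φ L) {u : Z → Vec d} (hu : Measurable u) :
    (pz.prod ν).map (fun p => Φ (u p.1) p.2)
      = volume.withDensity fun x => ENNReal.ofReal (mix kr (pz.map u) x) := by
  have : IsProbabilityMeasure (pz.map u) := Measure.isProbabilityMeasure_map hu.aemeasurable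
  refine Measure.ext_of_lintegral _ fun f hf => ?_
  have hm := hΦ.measurable_comp (Z := Z) hu
  rw [lintegral_map hf hm, lintegral_prod (fun p => f (Φ (u p.1) p.2)) (hf.comp hm).aemeasurable,
    lintegral_withDensity_eq_lintegral_mul _ (hk.measurable_mix _).ennreal_ofReal hf]
  simp_rw [Pi.mul_apply, mul_comm _ (f _)]
  have hkf : Measurable fun p : Vec d × Vec d => f p.2 * ENNReal.ofReal (kr p.1 p.2) :=
    (hf.comp measurable_snd).mul hk.measurable.ennreal_ofReal
  rw [hk.lintegral_mul_mix (pz.map u) hf, lintegral_map hkf.lintegral_prod_right' hu]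
  refine lintegral_congr fun z => ?_
  have hmz : Measurable (Φ (u z)) := hΦ.measurable.comp (by fun_prop : Measurable fun ω => (u z, ω))
  have hmk : Measurable (kr (u z)) :=
    hk.measurable.comp (by fun_prop : Measurable fun ω => (u z, ω))
  have h := lintegral_map (μ := ν) hf hmz
  rw [hΦ.law, lintegral_withDensity_eq_lintegral_mul _ hmk.ennreal_ofReal hf] at h
  rw [← h]
  exact lintegral_congr fun x => mul_comm _ _

variable [IsProbabilityMeasure ν] [IsProbabilityMeasure pz]

lemma IsSampler.integral_mix (hk : IsGaussianType kr A K D) (hΦ : IsSampler ν kr Φ L)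
    {u : Z → Vec d} (hu : Measurable u) {f : Vec d → ℝ} (hf : Measurable f) :
    ∫ x, f x ∂(volume.withDensity fun x => ENNReal.ofReal (mix kr (pz.map u) x))
      = ∫ p, f (Φ (u p.1) p.2) ∂(pz.prod ν) := by
  rw [← hΦ.map_comp hk hu,
    integral_map (hΦ.measurable_comp hu).aemeasurable hf.aestronglyMeasurable]

lemma IsSampler.toReal_klDiv (hk : IsGaussianType kr A K D) (hΦ : IsSampler ν kr Φ L)
    (μ : Measure (Vec d)) [IsProbabilityMeasure μ] {u : Z → Vec d} (hu : Measurable u) :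
    (klDiv (volume.withDensity fun x => ENNReal.ofReal (mix kr (pz.map u) x))
        (volume.withDensity fun x => ENNReal.ofReal (mix kr μ x))).toReal
      = ∫ p, (Real.log (mix kr (pz.map u) (Φ (u p.1) p.2)) - Real.log (mix kr μ (Φ (u p.1) p.2)))
          ∂(pz.prod ν) := by
  have : IsProbabilityMeasure (pz.map u) := Measure.isProbabilityMeasure_map hu.aemeasurable
  have := hk.isProbabilityMeasure_mix (pz.map u)
  have := hk.isProbabilityMeasure_mix μ
  rw [toReal_klDiv_withDensity (hk.measurable_mix _) (hk.measurable_mix _) (hk.mix_pos _)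
    (hk.mix_pos _)]
  exact hΦ.integral_mix hk hu ((hk.measurable_mix _).log.sub (hk.measurable_mix _).log)

/-- Two mixtures over coupled priors have relative entropy of second order in the coupling
distance. -/
lemma IsSampler.abs_integral_log_sub_log_le (hk : IsGaussianType kr A K D)
    (hΦ : IsSampler ν kr Φ L) {u v : Z → Vec d} (hu : Measurable u) (hv : Measurable v)
    (hu2 : MemLp u 2 pz) (hv2 : MemLp v 2 pz) :
    |∫ p, (Real.log (mix kr (pz.map u) (Φ (u p.1) p.2))
        - Real.log (mix kr (pz.map v) (Φ (u p.1) p.2))) ∂(pz.prod ν)|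
      ≤ 2 * (8 * D + 2) * K ^ 2 * ∫ z, ‖u z - v z‖ ^ 2 ∂pz := by
  have : IsProbabilityMeasure (pz.map u) := Measure.isProbabilityMeasure_map hu.aemeasurable
  have : IsProbabilityMeasure (pz.map v) := Measure.isProbabilityMeasure_map hv.aemeasurable
  have hpm := hk.measurable_mix (pz.map u)
  have hqm := hk.measurable_mix (pz.map v)
  obtain ⟨c₁, -, h₁, -⟩ := hk.exists_growth_log_mix (pz.map u)
  obtain ⟨c₂, -, h₂, -⟩ := hk.exists_growth_log_mix (pz.map v)
  have hfm : Measurable fun x => Real.log (mix kr (pz.map u) x) - Real.log (mix kr (pz.map v) x) :=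
    hpm.log.sub hqm.log
  have hint := integrable_comp_of_quadratic_growth (hΦ.measurable_comp (Z := Z) hu)
    (hΦ.memLp_comp hu hu2) hfm (c := c₁ + c₂) fun x => by
      rw [add_mul]; exact (abs_sub _ _).trans (add_le_add (h₁ x) (h₂ x))
  have hint' : Integrable (fun x => mix kr (pz.map u) x *
      (Real.log (mix kr (pz.map u) x) - Real.log (mix kr (pz.map v) x))) := by
    have h := (integrable_map_measure hfm.aestronglyMeasurable
      (hΦ.measurable_comp (Z := Z) hu).aemeasurable).2 hint
    rw [hΦ.map_comp hk hu, integrable_withDensity_iff_integrable_smul' hpm.ennreal_ofReal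
      (.of_forall fun x => ENNReal.ofReal_lt_top)] at h
    refine h.congr (.of_forall fun x => ?_)
    simp only [ENNReal.toReal_ofReal (hk.mix_pos _ x).le, smul_eq_mul]
  have hrel : ∫ p, (Real.log (mix kr (pz.map u) (Φ (u p.1) p.2))
      - Real.log (mix kr (pz.map v) (Φ (u p.1) p.2))) ∂(pz.prod ν)
      = ∫ x, relEnt (mix kr (pz.map u) x) (mix kr (pz.map v) x) := by
    rw [← hΦ.integral_mix hk hu hfm, integral_withDensity_eq_integral_toReal_smul
      hpm.ennreal_ofReal (.of_forall fun x => ENNReal.ofReal_lt_top)]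
    unfold relEnt
    rw [integral_add (f := fun x => mix kr (pz.map u) x *
        (Real.log (mix kr (pz.map u) x) - Real.log (mix kr (pz.map v) x)) - mix kr (pz.map u) x)
        (hint'.sub (hk.integrable_mix _)) (hk.integrable_mix _),
      integral_sub hint' (hk.integrable_mix _), hk.integral_mix (pz.map u),
      hk.integral_mix (pz.map v)]
    simp only [ENNReal.toReal_ofReal (hk.mix_pos _ _).le, smul_eq_mul]
    ring
  have h0 : ∀ x, 0 ≤ relEnt (mix kr (pz.map u) x) (mix kr (pz.map v) x) := fun x =>
    relEnt_nonneg (hk.mix_pos _ x) (hk.mix_pos _ x)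
  have hD := hk.nonneg_D
  rw [hrel, abs_of_nonneg (integral_nonneg h0),
    integral_eq_lintegral_of_nonneg_ae (.of_forall h0)]
  · exact ENNReal.toReal_le_of_le_ofReal
      (mul_nonneg (by positivity) (integral_nonneg fun z => by positivity))
      (hk.lintegral_relEnt_mix_le pz hu hv (hu2.sub hv2))
  · unfold relEnt
    exact (((hpm.mul hfm).sub hpm).add hqm).aestronglyMeasurable

end Sampler

section Derivative

variable {d k : ℕ} {kr : Vec d → Vec d → ℝ} {A K D L ε : ℝ}
  {W : Type*} [MeasurableSpace W] {ν : Measure W}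
  {Φ : Vec d → W → Vec d} {Z : Type*} [MeasurableSpace Z] {pz : Measure Z}
  {G : Vec k → Z → Vec d} {θ₀ : Vec k} {B : Z → ℝ}

lemma IsSampler.norm_fderiv_path_le (hΦ : IsSampler ν kr Φ L)
    (hG : IsRegularGenerator pz G θ₀ ε B) (p : Z × W) (θ : Vec k) :
    ‖fderiv ℝ (fun θ' => Φ (G θ' p.1) p.2) θ‖ ≤ L * ‖fderiv ℝ (fun θ' => G θ' p.1) θ‖ := by
  have h : fderiv ℝ (fun θ' => Φ (G θ' p.1) p.2) θ
      = (fderiv ℝ (fun y => Φ y p.2) (G θ p.1)).comp (fderiv ℝ (fun θ' => G θ' p.1) θ) :=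
    (HasFDerivAt.comp (g := fun y => Φ y p.2) (f := fun θ' => G θ' p.1) θ
      (hΦ.differentiable p.2 _).hasFDerivAt (hG.differentiable p.1 θ).hasFDerivAt).fderiv
  rw [h]
  refine (ContinuousLinearMap.opNorm_comp_le _ _).trans ?_
  gcongr
  exact hΦ.norm_fderiv_le _ _

lemma IsSampler.differentiable_path (hΦ : IsSampler ν kr Φ L)
    (hG : IsRegularGenerator pz G θ₀ ε B) (p : Z × W) :
    Differentiable ℝ fun θ => Φ (G θ p.1) p.2 :=
  (hΦ.differentiable p.2).comp (hG.differentiable p.1)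

variable [IsProbabilityMeasure ν] [IsProbabilityMeasure pz]

/-- The pullback along `∂x_t/∂θ` of the difference of the scores of the noised generator and of the
noised law `μ`, at the sample `x_t = Φ (G θ₀ z) ω`. -/
noncomputable def scoreVJP (kr : Vec d → Vec d → ℝ) (pz : Measure Z) (Φ : Vec d → W → Vec d)
    (G : Vec k → Z → Vec d) (μ : Measure (Vec d)) (θ₀ : Vec k) (p : Z × W) : Vec k :=
  ContinuousLinearMap.adjoint (fderiv ℝ (fun θ => Φ (G θ p.1) p.2) θ₀)
    (gradient (fun y => Real.log (mix kr (pz.map (G θ₀)) y)) (Φ (G θ₀ p.1) p.2)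
      - gradient (fun y => Real.log (mix kr μ y)) (Φ (G θ₀ p.1) p.2))

/-- The derivative of the divergence is the derivative of the mean of the fixed function
`log p_θ₀ - log p*` along the path of samples: the change of `log p_θ` itself contributes a relative
entropy, which is of second order. -/
theorem IsSampler.hasFDerivAt_klDiv (hk : IsGaussianType kr A K D) (hΦ : IsSampler ν kr Φ L)
    (hG : IsRegularGenerator pz G θ₀ ε B) (μ : Measure (Vec d)) [IsProbabilityMeasure μ] :
    HasFDerivAt (fun θ => (klDiv
        (volume.withDensity fun x => ENNReal.ofReal (mix kr (pz.map (G θ)) x))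
        (volume.withDensity fun x => ENNReal.ofReal (mix kr μ x))).toReal)
      (InnerProductSpace.toDual ℝ (Vec k) (∫ p, scoreVJP kr pz Φ G μ θ₀ p ∂(pz.prod ν))) θ₀ := by
  have hθ₀ : θ₀ ∈ Metric.ball θ₀ ε := Metric.mem_ball_self hG.pos
  have hprob : ∀ θ, IsProbabilityMeasure (pz.map (G θ)) := fun θ =>
    Measure.isProbabilityMeasure_map (hG.measurable θ).aemeasurable
  have hmem : ∀ θ ∈ Metric.ball θ₀ ε, MemLp (G θ) 2 pz := fun θ hθ =>
    (hG.exists_of_mem_ball hθ).choose_spec.memLp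
  set h : Vec d → ℝ := fun x => Real.log (mix kr (pz.map (G θ₀)) x) - Real.log (mix kr μ x) with hh
  have hhd : Differentiable ℝ h := (hk.differentiable_log_mix _).sub (hk.differentiable_log_mix μ)
  have hfderiv : ∀ x, fderiv ℝ h x
      = fderiv ℝ (fun x => Real.log (mix kr (pz.map (G θ₀)) x)) x
        - fderiv ℝ (fun x => Real.log (mix kr μ x)) x := fun x =>
    fderiv_fun_sub (hk.differentiable_log_mix _ x) (hk.differentiable_log_mix μ x)
  obtain ⟨c₁, hc₁, h₁, h₁'⟩ := hk.exists_growth_log_mix (pz.map (G θ₀))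
  obtain ⟨c₂, hc₂, h₂, h₂'⟩ := hk.exists_growth_log_mix μ
  have hgr : ∀ x, |h x| ≤ (c₁ + c₂) * (1 + ‖x‖ ^ 2) := fun x => by
    rw [add_mul]; exact (abs_sub _ _).trans (add_le_add (h₁ x) (h₂ x))
  have hgr' : ∀ x, ‖fderiv ℝ h x‖ ≤ (c₁ + c₂) * (1 + ‖x‖) := fun x => by
    rw [add_mul, hfderiv]; exact (norm_sub_le _ _).trans (add_le_add (h₁' x) (h₂' x))
  have hpath := hasFDerivAt_integral_comp_path (P := pz.prod ν)
    (X := fun θ p => Φ (G θ p.1) p.2) (H := fun p => L * B p.1) hG.pos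
    (fun θ => hΦ.measurable_comp (hG.measurable θ)) (hΦ.differentiable_path hG)
    (hΦ.memLp_comp (hG.measurable θ₀) hG.memLp)
    ((hG.memLp_bound.comp_measurePreserving measurePreserving_fst).const_mul L) (by
      filter_upwards [Measure.quasiMeasurePreserving_fst.ae hG.norm_fderiv_le] with p hp θ hθ
      refine (hΦ.norm_fderiv_path_le hG p θ).trans ?_
      have hL : 0 ≤ L := (norm_nonneg _).trans (hΦ.norm_fderiv_le p.2 0)
      gcongr
      exact hp θ hθ) hhd (add_nonneg hc₁ hc₂) hgr hgr'
  -- the part of the increment of the divergence that comes from the change of `log p_θ`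
  set R : Vec k → ℝ := fun θ => ∫ p, (Real.log (mix kr (pz.map (G θ)) (Φ (G θ p.1) p.2))
        - Real.log (mix kr (pz.map (G θ₀)) (Φ (G θ p.1) p.2))) ∂(pz.prod ν) with hR
  have hRd : HasFDerivAt R (0 : Vec k →L[ℝ] ℝ) θ₀ := by
    refine Asymptotics.IsBigO.hasFDerivAt (n := 2) ?_ one_lt_two
    refine Asymptotics.IsBigO.of_bound (2 * (8 * D + 2) * K ^ 2 * ∫ z, B z ^ 2 ∂pz) ?_
    filter_upwards [Metric.ball_mem_nhds θ₀ hG.pos] with θ hθ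
    have hD := hk.nonneg_D
    refine (hΦ.abs_integral_log_sub_log_le hk (hG.measurable θ) (hG.measurable θ₀) (hmem θ hθ)
      hG.memLp).trans ?_
    rw [mul_assoc _ (∫ z, B z ^ 2 ∂pz)]
    refine mul_le_mul_of_nonneg_left ?_ (by positivity)
    rw [norm_pow, norm_norm, ← integral_mul_const]
    refine integral_mono_ae (((hmem θ hθ).sub hG.memLp).integrable_norm_pow two_ne_zero)
      (hG.memLp_bound.integrable_sq.mul_const _) ?_
    filter_upwards [hG.norm_fderiv_le] with z hz
    have := norm_path_sub_le (hG.differentiable z) hz hθ₀ hθ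
    rw [← mul_pow]
    gcongr
  have hsum := hpath.add hRd
  have hderiv : ∫ p, (fderiv ℝ h (Φ (G θ₀ p.1) p.2)).comp
        (fderiv ℝ (fun θ => Φ (G θ p.1) p.2) θ₀) ∂(pz.prod ν)
      = InnerProductSpace.toDual ℝ (Vec k) (∫ p, scoreVJP kr pz Φ G μ θ₀ p ∂(pz.prod ν)) := by
    have hi := (InnerProductSpace.toDual ℝ (Vec k)).toContinuousLinearEquiv.integral_comp_comm
      (μ := pz.prod ν) (scoreVJP kr pz Φ G μ θ₀)
    refine Eq.trans (integral_congr_ae (.of_forall fun p => ?_)) hi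
    ext v
    simp [hfderiv, scoreVJP, gradient, ContinuousLinearMap.adjoint_inner_left]
  rw [add_zero, hderiv] at hsum
  refine hsum.congr_of_eventuallyEq ?_
  filter_upwards [Metric.ball_mem_nhds θ₀ hG.pos] with θ hθ
  have hX := hΦ.memLp_comp (hG.measurable θ) (hmem θ hθ)
  have hXm := hΦ.measurable_comp (Z := Z) (hG.measurable θ)
  obtain ⟨c₃, hc₃, h₃, -⟩ := hk.exists_growth_log_mix (pz.map (G θ))
  rw [hΦ.toReal_klDiv hk μ (hG.measurable θ), Pi.add_apply]
  have hi₁ := integrable_comp_of_quadratic_growth hXm hX hhd.continuous.measurable hgr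
  have hi₂ := integrable_comp_of_quadratic_growth hXm hX
    (f := fun x => Real.log (mix kr (pz.map (G θ)) x) - Real.log (mix kr (pz.map (G θ₀)) x))
    ((hk.measurable_mix _).log.sub (hk.measurable_mix _).log) (c := c₃ + c₁) (fun x => by
    rw [add_mul]; exact (abs_sub _ _).trans (add_le_add (h₃ x) (h₁ x)))
  rw [hR]
  simp only
  rw [← integral_add hi₁ hi₂]
  refine integral_congr_ae (.of_forall fun p => ?_)
  simp only [hh]
  ring

/-- The Cauchy-Schwarz inequality bounds the mean of the pulled back score difference by the
relative Fisher information, in a form that is locally uniform in the parameter. -/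
lemma IsSampler.integrable_scoreVJP (hk : IsGaussianType kr A K D) (hΦ : IsSampler ν kr Φ L)
    (hG : IsRegularGenerator pz G θ₀ ε B) (μ : Measure (Vec d)) {β b : ℝ}
    (hfisher : ∫⁻ x, ‖gradient (fun y => Real.log (mix kr (pz.map (G θ₀)) y)) x
        - gradient (fun y => Real.log (mix kr μ y)) x‖ₑ ^ 2
        ∂(volume.withDensity fun x => ENNReal.ofReal (mix kr (pz.map (G θ₀)) x))
      ≤ ENNReal.ofReal ((β * b) ^ 2)) :
    Integrable (scoreVJP kr pz Φ G μ θ₀) (pz.prod ν) ∧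
      ∫ p, ‖scoreVJP kr pz Φ G μ θ₀ p‖ ∂(pz.prod ν) ≤ L * |β| * (∫ z, B z ^ 2 ∂pz + b ^ 2) := by
  have hXm := hΦ.measurable_comp (Z := Z) (hG.measurable θ₀)
  set S : Vec d → Vec d := fun x => gradient (fun y => Real.log (mix kr (pz.map (G θ₀)) y)) x
        - gradient (fun y => Real.log (mix kr μ y)) x with hS
  have hSm : Measurable S := (measurable_gradient _).sub (measurable_gradient _)
  have hL : 0 ≤ L := by
    obtain ⟨ω⟩ : Nonempty W := ν.nonempty_of_neZero
    exact (norm_nonneg _).trans (hΦ.norm_fderiv_le ω 0)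
  have hSsq : ∫⁻ p, ‖S (Φ (G θ₀ p.1) p.2)‖ₑ ^ 2 ∂(pz.prod ν) ≤ ENNReal.ofReal ((β * b) ^ 2) := by
    rw [← hΦ.map_comp hk (hG.measurable θ₀), lintegral_map (hSm.enorm.pow_const 2) hXm] at hfisher
    exact hfisher
  have hS2 : MemLp (fun p : Z × W => S (Φ (G θ₀ p.1) p.2)) 2 (pz.prod ν) := by
    refine ⟨(hSm.comp hXm).aestronglyMeasurable, ?_⟩
    rw [eLpNorm_lt_top_iff_lintegral_rpow_enorm_lt_top two_ne_zero ENNReal.ofNat_ne_top]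
    simpa using hSsq.trans_lt ENNReal.ofReal_lt_top
  have hSXm : Measurable fun p : Z × W => ‖S (Φ (G θ₀ p.1) p.2)‖ ^ 2 :=
    (hSm.comp hXm).norm.pow_const 2
  have hSint : ∫ p, ‖S (Φ (G θ₀ p.1) p.2)‖ ^ 2 ∂(pz.prod ν) ≤ (β * b) ^ 2 := by
    rw [integral_eq_lintegral_of_nonneg_ae (.of_forall fun p => by positivity)
      hSXm.aestronglyMeasurable]
    refine ENNReal.toReal_le_of_le_ofReal (sq_nonneg _) (le_trans (le_of_eq ?_) hSsq)
    refine lintegral_congr fun p => ?_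
    rw [ENNReal.ofReal_pow (norm_nonneg _), ofReal_norm]
  have hB2 : MemLp (fun p : Z × W => ‖B p.1‖) 2 (pz.prod ν) :=
    hG.memLp_bound.norm.comp_measurePreserving measurePreserving_fst
  have hprod : Integrable (fun p : Z × W => ‖B p.1‖ * ‖S (Φ (G θ₀ p.1) p.2)‖) (pz.prod ν) :=
    hB2.integrable_mul hS2.norm
  have hle : ∀ᵐ p ∂(pz.prod ν), ‖scoreVJP kr pz Φ G μ θ₀ p‖
      ≤ L * (‖B p.1‖ * ‖S (Φ (G θ₀ p.1) p.2)‖) := by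
    filter_upwards [Measure.quasiMeasurePreserving_fst.ae hG.norm_fderiv_le] with p hp
    refine (ContinuousLinearMap.le_opNorm _ _).trans ?_
    rw [← mul_assoc, LinearIsometryEquiv.norm_map]
    gcongr
    refine (hΦ.norm_fderiv_path_le hG p θ₀).trans ?_
    gcongr
    exact (hp θ₀ (Metric.mem_ball_self hG.pos)).trans (le_abs_self _)
  have hint : Integrable (scoreVJP kr pz Φ G μ θ₀) (pz.prod ν) :=
    (hprod.const_mul L).mono' (stronglyMeasurable_vjp
      (fun θ => hΦ.measurable_comp (hG.measurable θ)) (hΦ.differentiable_path hG)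
      (hSm.comp hXm)).aestronglyMeasurable hle
  refine ⟨hint, ?_⟩
  have hCS := integral_mul_le_Lp_mul_Lq_of_nonneg (μ := pz.prod ν) (p := 2) (q := 2)
    Real.HolderConjugate.two_two (f := fun p => ‖B p.1‖)
    (g := fun p => ‖S (Φ (G θ₀ p.1) p.2)‖) (.of_forall fun p => norm_nonneg _)
    (.of_forall fun p => norm_nonneg _) (by simpa using hB2) (by simpa using hS2.norm)
  simp only [Real.rpow_two, ← Real.sqrt_eq_rpow] at hCS
  have hBint : ∫ p, ‖B p.1‖ ^ 2 ∂(pz.prod ν) = ∫ z, B z ^ 2 ∂pz := by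
    have := integral_fun_fst (μ := pz) (ν := ν) (fun z => ‖B z‖ ^ 2)
    simpa using this
  rw [hBint] at hCS
  have hB0 : 0 ≤ ∫ z, B z ^ 2 ∂pz := integral_nonneg fun z => sq_nonneg _
  calc _ ≤ ∫ p, L * (‖B p.1‖ * ‖S (Φ (G θ₀ p.1) p.2)‖) ∂(pz.prod ν) :=
        integral_mono_ae hint.norm (hprod.const_mul L) hle
    _ = L * ∫ p, ‖B p.1‖ * ‖S (Φ (G θ₀ p.1) p.2)‖ ∂(pz.prod ν) := integral_const_mul _ _
    _ ≤ L * (√(∫ z, B z ^ 2 ∂pz) * (|β| * |b|)) := by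
        gcongr
        refine hCS.trans ?_
        gcongr
        rw [← abs_mul, ← Real.sqrt_sq_eq_abs]
        exact Real.sqrt_le_sqrt hSint
    _ = L * |β| * (√(∫ z, B z ^ 2 ∂pz) * |b|) := by ring
    _ ≤ _ := by
        gcongr
        nlinarith [Real.sq_sqrt hB0, sq_abs b, sq_nonneg (√(∫ z, B z ^ 2 ∂pz) - |b|),
          Real.sqrt_nonneg (∫ z, B z ^ 2 ∂pz), abs_nonneg b]

end Derivative

/-! ### Reward tilting and the posterior -/

section Posterior

variable {d : ℕ} {q : ℝ → Vec d → Vec d → ℝ} {t A K D : ℝ}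

lemma integrable_exp_reward_mul (hk : IsGaussianType (q t) A K D) {μ : Measure (Vec d)}
    {f : Vec d → ℝ} (hf : Integrable (fun x₀ => Real.exp (f x₀)) μ) (x : Vec d) :
    Integrable (fun x₀ => q t x₀ x * Real.exp (f x₀)) μ :=
  hf.bdd_mul (hk.measurable_left x).aestronglyMeasurable (c := Real.exp A)
    (.of_forall fun x₀ => by
      rw [Real.norm_eq_abs, abs_of_pos (hk.pos _ _)]; exact hk.le_exp _ _)

lemma integrable_exp_posterior (hk : IsGaussianType (q t) A K D) (μ : Measure (Vec d))
    {f : Vec d → ℝ} (hf : Integrable (fun x₀ => Real.exp (f x₀)) μ) (x : Vec d) :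
    Integrable (fun x₀ => Real.exp (f x₀)) (posterior q μ t x) := by
  have hm : Measurable fun x₀ => q t x₀ x / marginal q μ t x := (hk.measurable_left x).div_const _
  have hm0 : 0 ≤ marginal q μ t x := integral_nonneg fun x₀ => (hk.pos x₀ x).le
  rw [posterior, integrable_withDensity_iff_integrable_smul' hm.ennreal_ofReal
    (.of_forall fun x => ENNReal.ofReal_lt_top)]
  refine ((integrable_exp_reward_mul hk hf x).const_mul (marginal q μ t x)⁻¹).congr
    (.of_forall fun x₀ => ?_)
  simp only [smul_eq_mul]
  rw [ENNReal.toReal_ofReal (div_nonneg (hk.pos _ _).le hm0)]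
  ring

/-- Bayes' rule: the posterior mean of `exp (r / τ)` is `Z` times the ratio of the tilted to the
untilted noised density. -/
lemma posteriorExpReward_eq (hk : IsGaussianType (q t) A K D) (μ : Measure (Vec d))
    {r : Vec d → ℝ} {τ : ℝ} (hZ : 0 < ∫ x₀, Real.exp (r x₀ / τ) ∂μ) (x : Vec d) :
    posteriorExpReward q μ r τ t x = (∫ x₀, Real.exp (r x₀ / τ) ∂μ)
      * (mix (q t) (rewardTilted μ r τ) x / mix (q t) μ x) := by
  have hm : Measurable fun x₀ => q t x₀ x / marginal q μ t x := (hk.measurable_left x).div_const _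
  have hm0 : 0 ≤ marginal q μ t x := integral_nonneg fun x₀ => (hk.pos x₀ x).le
  rw [posteriorExpReward, posterior, integral_withDensity_eq_integral_toReal_smul hm.ennreal_ofReal
    (.of_forall fun x => ENNReal.ofReal_lt_top), mix, rewardTilted, integral_tilted,
    ← integral_div, ← integral_const_mul]
  refine integral_congr_ae (.of_forall fun x₀ => ?_)
  simp only [smul_eq_mul]
  rw [ENNReal.toReal_ofReal (div_nonneg (hk.pos _ _).le hm0)]
  change q t x₀ x / mix (q t) μ x * _ = _
  field_simp

lemma log_posteriorExpReward_eq (hk : IsGaussianType (q t) A K D) (μ : Measure (Vec d))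
    [IsProbabilityMeasure μ] {r : Vec d → ℝ} {τ : ℝ}
    (hf : Integrable (fun x₀ => Real.exp (r x₀ / τ)) μ) :
    (fun x => Real.log (posteriorExpReward q μ r τ t x))
      = fun x => Real.log (∫ x₀, Real.exp (r x₀ / τ) ∂μ)
        + (Real.log (mix (q t) (rewardTilted μ r τ) x) - Real.log (mix (q t) μ x)) := by
  have hZ : 0 < ∫ x₀, Real.exp (r x₀ / τ) ∂μ := integral_exp_pos hf
  have : IsProbabilityMeasure (rewardTilted μ r τ) := isProbabilityMeasure_tilted hf
  funext x
  have h1 := hk.mix_pos μ x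
  have h2 := hk.mix_pos (rewardTilted μ r τ) x
  rw [posteriorExpReward_eq hk μ hZ, Real.log_mul hZ.ne' (div_pos h2 h1).ne',
    Real.log_div h2.ne' h1.ne']

lemma differentiable_log_posteriorExpReward (hk : IsGaussianType (q t) A K D) (μ : Measure (Vec d))
    [IsProbabilityMeasure μ] {r : Vec d → ℝ} {τ : ℝ}
    (hf : Integrable (fun x₀ => Real.exp (r x₀ / τ)) μ) :
    Differentiable ℝ fun x => Real.log (posteriorExpReward q μ r τ t x) := by
  have : IsProbabilityMeasure (rewardTilted μ r τ) := isProbabilityMeasure_tilted hf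
  rw [log_posteriorExpReward_eq hk μ hf]
  exact ((hk.differentiable_log_mix _).sub (hk.differentiable_log_mix _)).const_add _

lemma score_rewardTilted (hk : IsGaussianType (q t) A K D) (μ : Measure (Vec d))
    [IsProbabilityMeasure μ] {r : Vec d → ℝ} {τ : ℝ}
    (hf : Integrable (fun x₀ => Real.exp (r x₀ / τ)) μ) (x : Vec d) :
    score q (rewardTilted μ r τ) t x = score q μ t x + diffusedRewardScore q μ r τ t x := by
  have : IsProbabilityMeasure (rewardTilted μ r τ) := isProbabilityMeasure_tilted hf
  rw [diffusedRewardScore, log_posteriorExpReward_eq hk μ hf, gradient, fderiv_const_add,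
    fderiv_fun_sub (hk.differentiable_log_mix _ x) (hk.differentiable_log_mix _ x), map_sub]
  exact (add_sub_cancel (score q μ t x) (score q (rewardTilted μ r τ) t x)).symm

end Posterior

/-! ### The forward process at a fixed noise level -/

section Noising

variable {d : ℕ} {W : Type*} [MeasurableSpace W] {ν : Measure W}
  {T L t : ℝ} {F : Vec d → W → ℝ → Vec d} {q : ℝ → Vec d → Vec d → ℝ}

lemma IsNoisingProcess.isSampler (hF : IsNoisingProcess ν T F q) (hreg : IsRegularNoising ν T F q L)
    (ht : t ∈ Ioc 0 T) : IsSampler ν (q t) (fun x₀ ω => F x₀ ω t) L where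
  measurable := hF.measurable_F.comp
    (by fun_prop : Measurable fun p : Vec d × W => (p.1, p.2, t))
  law := hF.law_eq t ht
  differentiable := hreg.differentiable_F t ht
  norm_fderiv_le := hreg.norm_fderiv_F_le t ht
  memLp := hreg.memLp_F t ht

lemma IsNoisingProcess.exists_isGaussianType [IsProbabilityMeasure ν]
    (hF : IsNoisingProcess ν T F q) (hreg : IsRegularNoising ν T F q L) (ht : t ∈ Ioc 0 T) :
    ∃ A K D, IsGaussianType (q t) A K D := by
  obtain ⟨A, K, D, hA, hK, hD⟩ := hreg.gaussian_type t ht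
  refine ⟨A, max K 0, max D 0, ?_, hreg.pos t ht, hreg.differentiable_q t ht, hA, le_max_right _ _,
    le_max_right _ _, fun x₀ x y₀ y => (hK x₀ x y₀ y).trans ?_,
    fun x₀ => (hD x₀).trans (ENNReal.ofReal_le_ofReal (le_max_left _ _)), fun x₀ => ?_⟩
  · exact hF.measurable_q.comp (by fun_prop : Measurable fun p : Vec d × Vec d => (t, p.1, p.2))
  · gcongr
    exact le_max_left _ _
  · have hm : Measurable fun ω => F x₀ ω t :=
      hF.measurable_F.comp (by fun_prop : Measurable fun ω : W => (x₀, ω, t))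
    have h := congrArg (fun m => m univ) (hF.law_eq t ht x₀)
    simp only [Measure.map_apply hm .univ, preimage_univ, measure_univ,
      withDensity_apply _ MeasurableSet.univ, setLIntegral_univ] at h
    exact h.symm

end Noising

/-! ### Joint measurability in the prompt, the noise level and the image -/

section Measurability

variable {d : ℕ} {C : Type*} [MeasurableSpace C] {q : ℝ → Vec d → Vec d → ℝ} {T : ℝ}

lemma measurable_integral_kernel_fst {β γ : Type*} [MeasurableSpace β] [MeasurableSpace γ]
    (κ : Kernel C β) [IsSFiniteKernel κ] {f : C × γ → β → ℝ}
    (hf : Measurable (Function.uncurry f)) : Measurable fun p => ∫ y, f p y ∂(κ p.1) := by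
  have h := StronglyMeasurable.integral_kernel_prod_right
    (κ := κ.comap (Prod.fst : C × γ → C) measurable_fst) hf.stronglyMeasurable
  simpa using h.measurable

lemma measurable_marginal_genLaw {Z : Type*} [MeasurableSpace Z] (pz : Measure Z) [SFinite pz]
    (hq : Measurable fun p : ℝ × Vec d × Vec d => q p.1 p.2.1 p.2.2) {u : Z → C → Vec d}
    (hu : Measurable fun p : C × Z => u p.2 p.1) :
    Measurable fun p : C × ℝ × Vec d => marginal q (genLaw pz fun z => u z p.1) p.2.1 p.2.2 := by
  have h : (fun p : C × ℝ × Vec d => marginal q (genLaw pz fun z => u z p.1) p.2.1 p.2.2)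
      = fun p => ∫ z, q p.2.1 (u z p.1) p.2.2 ∂pz := by
    funext p
    refine integral_map (hu.comp (by fun_prop : Measurable fun z : Z => (p.1, z))).aemeasurable ?_
    exact (hq.comp (by fun_prop : Measurable fun x₀ : Vec d =>
      (p.2.1, x₀, p.2.2))).aestronglyMeasurable
  rw [h]
  have hm : Measurable fun p : (C × ℝ × Vec d) × Z => q p.1.2.1 (u p.2 p.1.1) p.1.2.2 :=
    hq.comp (Measurable.prodMk (by fun_prop) (Measurable.prodMk
      (hu.comp (by fun_prop : Measurable fun p : (C × ℝ × Vec d) × Z => (p.1.1, p.2)))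
      (by fun_prop)))
  exact hm.stronglyMeasurable.integral_prod_right'.measurable

lemma measurable_marginal_rewardTilted (q0 : Kernel C (Vec d)) [IsSFiniteKernel q0]
    (hq : Measurable fun p : ℝ × Vec d × Vec d => q p.1 p.2.1 p.2.2)
    {r : Vec d → C → ℝ} (hr : Measurable fun p : Vec d × C => r p.1 p.2) (τ : ℝ) :
    Measurable fun p : C × ℝ × Vec d =>
      marginal q (rewardTilted (q0 p.1) (fun x₀ => r x₀ p.1) τ) p.2.1 p.2.2 := by
  simp only [marginal, rewardTilted, integral_tilted]
  have hr' : Measurable fun p : (C × ℝ × Vec d) × Vec d => Real.exp (r p.2 p.1.1 / τ) :=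
    ((hr.comp (by fun_prop : Measurable fun p : (C × ℝ × Vec d) × Vec d =>
      (p.2, p.1.1))).div_const τ).exp
  have hZ : Measurable fun p : C × ℝ × Vec d => ∫ x, Real.exp (r x p.1 / τ) ∂(q0 p.1) :=
    measurable_integral_kernel_fst q0 hr'
  refine measurable_integral_kernel_fst q0
    (f := fun (p : C × ℝ × Vec d) (x₀ : Vec d) =>
      (Real.exp (r x₀ p.1 / τ) / ∫ x, Real.exp (r x p.1 / τ) ∂(q0 p.1))
      • q p.2.1 x₀ p.2.2) ?_
  exact (hr'.div (hZ.comp measurable_fst)).smul (hq.comp (by fun_prop :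
    Measurable fun p : (C × ℝ × Vec d) × Vec d => (p.1.2.1, p.2, p.1.2.2)))

/-- Outside `(0, T]` the score has no meaning and is cut off to zero. -/
lemma measurable_score (μ : C → Measure (Vec d))
    (hm : Measurable fun p : C × ℝ × Vec d => marginal q (μ p.1) p.2.1 p.2.2)
    (hd : ∀ c, ∀ t ∈ Ioc 0 T, Differentiable ℝ fun x => Real.log (marginal q (μ c) t x)) :
    Measurable fun p : C × ℝ × Vec d =>
      if p.2.1 ∈ Ioc 0 T then score q (μ p.1) p.2.1 p.2.2 else 0 := by
  classical
  have hs : MeasurableSet {p : C × ℝ × Vec d | p.2.1 ∈ Ioc 0 T} :=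
    measurableSet_Ioc.preimage (by fun_prop)
  have h := measurable_fderiv_param (α := C × ℝ × Vec d)
    (fun p y => if p.2.1 ∈ Ioc 0 T then Real.log (marginal q (μ p.1) p.2.1 y) else 0)
    (fun p => p.2.2) (fun v => Measurable.ite hs
      (hm.comp (by fun_prop : Measurable fun p : C × ℝ × Vec d => (p.1, p.2.1, p.2.2 + v))).log
      measurable_const) (fun p => by
        by_cases hp : p.2.1 ∈ Ioc 0 T
        · simpa only [hp, if_true] using hd p.1 p.2.1 hp p.2.2
        · simp only [hp, if_false]; exact differentiableAt_const _)
  have h' := ((InnerProductSpace.toDual ℝ (Vec d)).symm.continuous.comp_stronglyMeasurable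
    h).measurable
  convert h' using 1
  funext p
  by_cases hp : p.2.1 ∈ Ioc 0 T
  · simp only [hp, if_true]; rfl
  · simp [hp]

/-- The divergence is an integral over images of a jointly measurable function of the two noised
densities. -/
lemma aemeasurable_klDiv_marginalMeasure (μ μ' : C → Measure (Vec d))
    [∀ c, IsProbabilityMeasure (μ c)] [∀ c, IsProbabilityMeasure (μ' c)]
    (hk : ∀ t ∈ Ioc 0 T, ∃ A K D, IsGaussianType (q t) A K D)
    (hm : Measurable fun p : C × ℝ × Vec d => marginal q (μ p.1) p.2.1 p.2.2)
    (hm' : Measurable fun p : C × ℝ × Vec d => marginal q (μ' p.1) p.2.1 p.2.2)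
    {M : Measure (C × ℝ)} (hM : ∀ᵐ p ∂M, p.2 ∈ Ioc 0 T) :
    AEMeasurable (fun p : C × ℝ =>
      klDiv (marginalMeasure q (μ p.1) p.2) (marginalMeasure q (μ' p.1) p.2)) M := by
  have ha : Measurable fun p : (C × ℝ) × Vec d => marginal q (μ p.1.1) p.1.2 p.2 :=
    hm.comp (by fun_prop : Measurable fun p : (C × ℝ) × Vec d => (p.1.1, p.1.2, p.2))
  have hb : Measurable fun p : (C × ℝ) × Vec d => marginal q (μ' p.1.1) p.1.2 p.2 :=
    hm'.comp (by fun_prop : Measurable fun p : (C × ℝ) × Vec d => (p.1.1, p.1.2, p.2))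
  have hf : Measurable fun p : (C × ℝ) × Vec d => ENNReal.ofReal (marginal q (μ' p.1.1) p.1.2 p.2)
      * ENNReal.ofReal (klFun (marginal q (μ p.1.1) p.1.2 p.2 / marginal q (μ' p.1.1) p.1.2 p.2)) :=
    hb.ennreal_ofReal.mul (measurable_klFun.comp (ha.div hb)).ennreal_ofReal
  refine ⟨_, hf.lintegral_prod_right' (ν := volume), ?_⟩
  filter_upwards [hM] with p hp
  obtain ⟨A, K, D, hkt⟩ := hk p.2 hp
  have : IsProbabilityMeasure (marginalMeasure q (μ p.1) p.2) :=
    hkt.isProbabilityMeasure_mix (μ p.1)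
  have : IsProbabilityMeasure (marginalMeasure q (μ' p.1) p.2) :=
    hkt.isProbabilityMeasure_mix (μ' p.1)
  unfold marginalMeasure at *
  exact klDiv_withDensity_eq_lintegral (hkt.measurable_mix (μ p.1)) (hkt.measurable_mix (μ' p.1))
    (hkt.mix_pos (μ p.1)) (hkt.mix_pos (μ' p.1))

end Measurability

/-! ### Reordering the sampling variables -/

section Reorder

variable {C Z W : Type*} [MeasurableSpace C] [MeasurableSpace Z] [MeasurableSpace W]

/-- The regrouping `((c, t), (z, ω)) ↦ (c, z, ω, t)`. -/
def reorder (C Z W : Type*) [MeasurableSpace C] [MeasurableSpace Z] [MeasurableSpace W] :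
    (C × ℝ) × (Z × W) ≃ᵐ C × Z × W × ℝ :=
  MeasurableEquiv.prodAssoc.trans ((MeasurableEquiv.refl C).prodCongr
    (MeasurableEquiv.prodComm.trans MeasurableEquiv.prodAssoc))

variable (PC : Measure C) (pz : Measure Z) (ν : Measure W)

lemma measurePreserving_reorder [SFinite PC] [SFinite pz] [SFinite ν] (κ : Measure ℝ) [SFinite κ] :
    MeasurePreserving (reorder C Z W) ((PC.prod κ).prod (pz.prod ν))
      (PC.prod (pz.prod (ν.prod κ))) :=
  ((MeasurePreserving.id PC).prod ((measurePreserving_prodAssoc pz ν κ).comp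
    Measure.measurePreserving_swap)).comp (measurePreserving_prodAssoc PC κ (pz.prod ν))

lemma prod_timeLaw_prod [SFinite PC] {η : ℝ → ℝ} (hη : Measurable η) (T : ℝ) (P : Measure (Z × W))
    [SFinite P] :
    (PC.prod (timeLaw T η)).prod P
      = ((PC.prod (volume.restrict (Ioc 0 T))).prod P).withDensity
          fun y => ENNReal.ofReal (η y.1.2) := by
  rw [timeLaw, prod_withDensity_right hη.ennreal_ofReal,
    prod_withDensity_left (by fun_prop)]

variable {V : Type*} [NormedAddCommGroup V] [NormedSpace ℝ V] {T : ℝ} {w η : ℝ → ℝ}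

lemma smul_weight_ae_eq (hη0 : ∀ t ∈ Ioc 0 T, 0 < η t) (f : C × Z × W × ℝ → V) :
    (fun y : (C × ℝ) × (Z × W) => (ENNReal.ofReal (η y.1.2)).toReal •
        ((w y.1.2 / η y.1.2) • f (reorder C Z W y)))
      =ᵐ[(PC.prod (volume.restrict (Ioc 0 T))).prod (pz.prod ν)]
        fun y => w y.1.2 • f (y.1.1, y.2.1, y.2.2, y.1.2) := by
  have h : ∀ᵐ p ∂(PC.prod (volume.restrict (Ioc 0 T))), p.2 ∈ Ioc 0 T :=
    Measure.quasiMeasurePreserving_snd.ae (ae_restrict_mem measurableSet_Ioc)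
  filter_upwards [Measure.quasiMeasurePreserving_fst.ae h] with y hy
  have := hη0 _ hy
  rw [ENNReal.toReal_ofReal this.le, smul_smul, mul_div_cancel₀ _ this.ne']
  rfl

variable [SFinite PC] [SFinite pz] [SFinite ν]

/-- Importance sampling of the noise level. -/
lemma integrable_smul_weight_iff (hη : Measurable η) (hη0 : ∀ t ∈ Ioc 0 T, 0 < η t)
    (f : C × Z × W × ℝ → V) :
    Integrable (fun p : C × Z × W × ℝ => (w p.2.2.2 / η p.2.2.2) • f p)
        (PC.prod (pz.prod (ν.prod (timeLaw T η)))) ↔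
      Integrable (fun y : (C × ℝ) × (Z × W) => w y.1.2 • f (y.1.1, y.2.1, y.2.2, y.1.2))
        ((PC.prod (volume.restrict (Ioc 0 T))).prod (pz.prod ν)) := by
  have : SFinite (timeLaw T η) := by unfold timeLaw; infer_instance
  rw [← (measurePreserving_reorder PC pz ν (timeLaw T η)).integrable_comp_emb
    (reorder C Z W).measurableEmbedding, prod_timeLaw_prod PC hη,
    integrable_withDensity_iff_integrable_smul' (by fun_prop)
      (.of_forall fun y => ENNReal.ofReal_lt_top)]
  exact integrable_congr (smul_weight_ae_eq PC pz ν hη0 f)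

lemma integral_smul_weight (hη : Measurable η) (hη0 : ∀ t ∈ Ioc 0 T, 0 < η t)
    (f : C × Z × W × ℝ → V) :
    ∫ p : C × Z × W × ℝ, (w p.2.2.2 / η p.2.2.2) • f p
        ∂(PC.prod (pz.prod (ν.prod (timeLaw T η)))) =
      ∫ y : (C × ℝ) × (Z × W), w y.1.2 • f (y.1.1, y.2.1, y.2.2, y.1.2)
        ∂((PC.prod (volume.restrict (Ioc 0 T))).prod (pz.prod ν)) := by
  have : SFinite (timeLaw T η) := by unfold timeLaw; infer_instance
  rw [← (measurePreserving_reorder PC pz ν (timeLaw T η)).integral_comp', prod_timeLaw_prod PC hη,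
    integral_withDensity_eq_integral_toReal_smul (by fun_prop)
      (.of_forall fun y => ENNReal.ofReal_lt_top)]
  exact integral_congr_ae (smul_weight_ae_eq PC pz ν hη0 f)

end Reorder

/-! ### Differentiating the objective under the integral -/

lemma IsRegularGenerator.mono {d k : ℕ} {Z : Type*} [MeasurableSpace Z] {pz : Measure Z}
    {G : Vec k → Z → Vec d} {θ₀ : Vec k} {ε ε' : ℝ} {B : Z → ℝ}
    (hG : IsRegularGenerator pz G θ₀ ε B) (hε' : 0 < ε') (h : ε' ≤ ε) :
    IsRegularGenerator pz G θ₀ ε' B where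
  measurable := hG.measurable
  differentiable := hG.differentiable
  memLp := hG.memLp
  pos := hε'
  memLp_bound := hG.memLp_bound
  norm_fderiv_le := by
    filter_upwards [hG.norm_fderiv_le] with z hz θ hθ using hz θ (Metric.ball_subset_ball h hθ)

section Objective

variable {d k : ℕ} {C Z W : Type*}
    [MeasurableSpace C] [MeasurableSpace Z] [MeasurableSpace W]
    {PC : Measure C} {pz : Measure Z} {ν : Measure W} [IsProbabilityMeasure ν] {T L τ : ℝ}
    {F : Vec d → W → ℝ → Vec d} {q : ℝ → Vec d → Vec d → ℝ}
    {q0 : Kernel C (Vec d)} [IsMarkovKernel q0] {r : Vec d → C → ℝ}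
    {w : ℝ → ℝ} {g : Vec k → Z → C → Vec d}

lemma scoreMismatchVJP_eq (hF : IsNoisingProcess ν T F q) (hreg : IsRegularNoising ν T F q L)
    (hZ : ∀ c, Integrable (fun x₀ => Real.exp (r x₀ c / τ)) (q0 c)) (θ : Vec k) (c : C) {t : ℝ}
    (ht : t ∈ Ioc 0 T) (p : Z × W) :
    scoreMismatchVJP pz F q q0 r τ g θ c p.1 p.2 t
      = scoreVJP (q t) pz (fun x₀ ω => F x₀ ω t) (fun θ z => g θ z c)
          (rewardTilted (q0 c) (fun x₀ => r x₀ c) τ) θ p := by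
  obtain ⟨A, K, D, hk⟩ := hF.exists_isGaussianType hreg ht
  rw [scoreMismatchVJP, sub_sub, ← score_rewardTilted hk (q0 c) (hZ c)]
  rfl

variable [IsProbabilityMeasure pz]

lemma aemeasurable_weight_mul_klDiv (hF : IsNoisingProcess ν T F q)
    (hreg : IsRegularNoising ν T F q L) (hr : Measurable fun p : Vec d × C => r p.1 p.2)
    (hZ : ∀ c, Integrable (fun x₀ => Real.exp (r x₀ c / τ)) (q0 c)) (hw : Measurable w)
    (hg : ∀ θ, Measurable fun p : C × Z => g θ p.2 p.1) (θ : Vec k) :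
    AEMeasurable (fun p : C × ℝ => ENNReal.ofReal (w p.2) *
        klDiv (marginalMeasure q (genLaw pz fun z => g θ z p.1) p.2)
          (marginalMeasure q (rewardTilted (q0 p.1) (fun x₀ => r x₀ p.1) τ) p.2))
      (PC.prod (volume.restrict (Ioc 0 T))) := by
  have hprob : ∀ c, IsProbabilityMeasure (genLaw pz fun z => g θ z c) := fun c =>
    Measure.isProbabilityMeasure_map
      ((hg θ).comp (by fun_prop : Measurable fun z : Z => (c, z))).aemeasurable
  have hprob' : ∀ c, IsProbabilityMeasure (rewardTilted (q0 c) (fun x₀ => r x₀ c) τ) := fun c =>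
    isProbabilityMeasure_tilted (hZ c)
  refine (hw.comp measurable_snd).ennreal_ofReal.aemeasurable.mul ?_
  exact aemeasurable_klDiv_marginalMeasure (fun c => genLaw pz fun z => g θ z c)
    (fun c => rewardTilted (q0 c) (fun x₀ => r x₀ c) τ)
    (fun t ht => hF.exists_isGaussianType hreg ht)
    (measurable_marginal_genLaw pz hF.measurable_q (hg θ))
    (measurable_marginal_rewardTilted q0 hF.measurable_q hr τ)
    (Measure.quasiMeasurePreserving_snd.ae (ae_restrict_mem measurableSet_Ioc))

lemma aestronglyMeasurable_scoreMismatchVJP (hF : IsNoisingProcess ν T F q)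
    (hreg : IsRegularNoising ν T F q L) (hr : Measurable fun p : Vec d × C => r p.1 p.2)
    (hZ : ∀ c, Integrable (fun x₀ => Real.exp (r x₀ c / τ)) (q0 c))
    (hg : ∀ θ, Measurable fun p : C × Z => g θ p.2 p.1)
    (hgd : ∀ z c, Differentiable ℝ fun θ => g θ z c) (θ : Vec k) :
    AEStronglyMeasurable (fun y : (C × ℝ) × (Z × W) =>
        scoreMismatchVJP pz F q q0 r τ g θ y.1.1 y.2.1 y.2.2 y.1.2)
      ((PC.prod (volume.restrict (Ioc 0 T))).prod (pz.prod ν)) := by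
  classical
  have hprob : ∀ c, IsProbabilityMeasure (genLaw pz fun z => g θ z c) := fun c =>
    Measure.isProbabilityMeasure_map
      ((hg θ).comp (by fun_prop : Measurable fun z : Z => (c, z))).aemeasurable
  have hprob' : ∀ c, IsProbabilityMeasure (rewardTilted (q0 c) (fun x₀ => r x₀ c) τ) := fun c =>
    isProbabilityMeasure_tilted (hZ c)
  have hs : MeasurableSet {y : (C × ℝ) × (Z × W) | y.1.2 ∈ Ioc 0 T} :=
    measurableSet_Ioc.preimage (by fun_prop)
  have hFm : ∀ θ, Measurable fun y : (C × ℝ) × (Z × W) => F (g θ y.2.1 y.1.1) y.2.2 y.1.2 :=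
    fun θ => hF.measurable_F.comp (Measurable.prodMk
      ((hg θ).comp (by fun_prop : Measurable fun y : (C × ℝ) × (Z × W) => (y.1.1, y.2.1)))
      (by fun_prop : Measurable fun y : (C × ℝ) × (Z × W) => (y.2.2, y.1.2)))
  have hlog : ∀ (μ : C → Measure (Vec d)) [∀ c, IsProbabilityMeasure (μ c)], ∀ c, ∀ t ∈ Ioc 0 T,
      Differentiable ℝ fun x => Real.log (marginal q (μ c) t x) := by
    intro μ _ c t ht
    obtain ⟨A, K, D, hk⟩ := hF.exists_isGaussianType hreg ht
    exact hk.differentiable_log_mix (μ c)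
  have hpt : Measurable fun y : (C × ℝ) × (Z × W) =>
      (y.1.1, y.1.2, F (g θ y.2.1 y.1.1) y.2.2 y.1.2) :=
    (measurable_fst.comp measurable_fst).prodMk
      ((measurable_snd.comp measurable_fst).prodMk (hFm θ))
  have hs1 := (measurable_score (fun c => genLaw pz fun z => g θ z c)
    (measurable_marginal_genLaw pz hF.measurable_q (hg θ)) (hlog _)).comp hpt
  have hs2 := (measurable_score (fun c => rewardTilted (q0 c) (fun x₀ => r x₀ c) τ)
    (measurable_marginal_rewardTilted q0 hF.measurable_q hr τ) (hlog _)).comp hpt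
  have hv := stronglyMeasurable_vjp (θ₀ := θ) (X := fun θ (y : (C × ℝ) × (Z × W)) =>
      if y.1.2 ∈ Ioc 0 T then F (g θ y.2.1 y.1.1) y.2.2 y.1.2 else 0)
    (fun θ => Measurable.ite hs (hFm θ) measurable_const) (fun y => by
      by_cases hy : y.1.2 ∈ Ioc 0 T
      · simp only [hy, if_true]
        exact (hreg.differentiable_F _ hy y.2.2).comp (hgd y.2.1 y.1.1)
      · simp only [hy, if_false]
        exact differentiable_const _) (hs1.sub hs2)
  refine ⟨_, hv, ?_⟩
  have h : ∀ᵐ p ∂(PC.prod (volume.restrict (Ioc 0 T))), p.2 ∈ Ioc 0 T :=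
    Measure.quasiMeasurePreserving_snd.ae (ae_restrict_mem measurableSet_Ioc)
  filter_upwards [Measure.quasiMeasurePreserving_fst.ae h] with y hy
  rw [scoreMismatchVJP_eq hF hreg hZ θ y.1.1 hy y.2]
  simp only [hy, if_true, scoreVJP, Pi.sub_apply, Function.comp]
  rfl

variable [IsProbabilityMeasure PC]

lemma ae_isRegularGenerator (hg : ∀ θ, Measurable fun p : C × Z => g θ p.2 p.1)
    (hgd : ∀ z c, Differentiable ℝ fun θ => g θ z c) {θ₀ : Vec k}
    (hg2 : ∀ᵐ c ∂PC, MemLp (fun z => g θ₀ z c) 2 pz) {ε : ℝ} (hε : 0 < ε) {G : C × Z → ℝ}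
    (hG : MemLp G 2 (PC.prod pz)) (hgG : ∀ᵐ p ∂(PC.prod pz), ∀ θ ∈ Metric.ball θ₀ ε,
        ‖fderiv ℝ (fun θ' => g θ' p.2 p.1) θ‖ ≤ G p) :
    ∀ᵐ c ∂PC, IsRegularGenerator pz (fun θ z => g θ z c) θ₀ ε (fun z => G (c, z)) := by
  filter_upwards [hg2, Measure.ae_ae_of_ae_prod hgG, hG.aestronglyMeasurable.prodMk_left,
    hG.integrable_sq.prod_right_ae] with c h1 h2 h3 h4
  exact ⟨fun θ => (hg θ).comp (by fun_prop : Measurable fun z : Z => (c, z)), fun z => hgd z c, h1,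
    hε, (memLp_two_iff_integrable_sq h3).2 h4, h2⟩

/-- The score formula for the derivative of the objective, before regrouping the sampling variables
and reweighting the noise level. -/
theorem hasGradientAt_loss (hF : IsNoisingProcess ν T F q)
    (hreg : IsRegularNoising ν T F q L) (hr : Measurable fun p : Vec d × C => r p.1 p.2)
    (hZ : ∀ c, Integrable (fun x₀ => Real.exp (r x₀ c / τ)) (q0 c))
    (hw : Measurable w) (hw0 : ∀ t ∈ Ioc 0 T, 0 ≤ w t)
    (hg : ∀ θ, Measurable fun p : C × Z => g θ p.2 p.1)
    (hgd : ∀ z c, Differentiable ℝ fun θ => g θ z c) {θ₀ : Vec k}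
    (hg2 : ∀ᵐ c ∂PC, MemLp (fun z => g θ₀ z c) 2 pz)
    (hgG : ∃ ε > 0, ∃ G : C × Z → ℝ, MemLp G 2 (PC.prod pz) ∧
      ∀ᵐ p ∂(PC.prod pz), ∀ θ ∈ Metric.ball θ₀ ε,
        ‖fderiv ℝ (fun θ' => g θ' p.2 p.1) θ‖ ≤ G p)
    (hloss : ∀ θ, loss PC pz T w q q0 r τ g θ < ∞)
    (hfisher : ∃ ε > 0, ∃ (β : ℝ → ℝ) (b : C → ℝ),
      IntegrableOn (fun t => w t * β t) (Ioc 0 T) ∧ MemLp b 2 PC ∧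
      ∀ᵐ c ∂PC, ∀ t ∈ Ioc 0 T, ∀ θ ∈ Metric.ball θ₀ ε,
        fisherDiv q (genLaw pz fun z => g θ z c)
          (rewardTilted (q0 c) (fun x₀ => r x₀ c) τ) t ≤ ENNReal.ofReal ((β t * b c) ^ 2)) :
    Integrable (fun y : (C × ℝ) × (Z × W) => w y.1.2 •
        scoreMismatchVJP pz F q q0 r τ g θ₀ y.1.1 y.2.1 y.2.2 y.1.2)
      ((PC.prod (volume.restrict (Ioc 0 T))).prod (pz.prod ν)) ∧
    HasGradientAt (fun θ => (loss PC pz T w q q0 r τ g θ).toReal)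
      (∫ y : (C × ℝ) × (Z × W), w y.1.2 •
          scoreMismatchVJP pz F q q0 r τ g θ₀ y.1.1 y.2.1 y.2.2 y.1.2
        ∂((PC.prod (volume.restrict (Ioc 0 T))).prod (pz.prod ν))) θ₀ := by
  obtain ⟨ε₁, hε₁, G, hG, hgG⟩ := hgG
  obtain ⟨ε₂, hε₂, β, b, hβ, hb, hfisher⟩ := hfisher
  have hε : 0 < min ε₁ ε₂ := lt_min hε₁ hε₂
  set M := PC.prod (volume.restrict (Ioc 0 T)) with hM
  have hprob' : ∀ c, IsProbabilityMeasure (rewardTilted (q0 c) (fun x₀ => r x₀ c) τ) := fun c =>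
    isProbabilityMeasure_tilted (hZ c)
  have hIoc : ∀ᵐ p ∂M, p.2 ∈ Ioc 0 T :=
    Measure.quasiMeasurePreserving_snd.ae (ae_restrict_mem measurableSet_Ioc)
  have hgen : ∀ᵐ p ∂M, IsRegularGenerator pz (fun θ z => g θ z p.1) θ₀ (min ε₁ ε₂)
      (fun z => G (p.1, z)) := by
    refine Measure.quasiMeasurePreserving_fst.ae (p := fun c => IsRegularGenerator pz
      (fun θ z => g θ z c) θ₀ (min ε₁ ε₂) (fun z => G (c, z))) ?_
    filter_upwards [ae_isRegularGenerator hg hgd hg2 hε₁ hG hgG] with c hc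
    exact hc.mono hε (min_le_left _ _)
  have hfish : ∀ᵐ p ∂M, ∀ θ ∈ Metric.ball θ₀ (min ε₁ ε₂),
      fisherDiv q (genLaw pz fun z => g θ z p.1)
          (rewardTilted (q0 p.1) (fun x₀ => r x₀ p.1) τ) p.2
        ≤ ENNReal.ofReal ((β p.2 * b p.1) ^ 2) := by
    filter_upwards [hIoc, Measure.quasiMeasurePreserving_fst.ae hfisher] with p hp hp' θ hθ
    exact hp' p.2 hp θ (Metric.ball_subset_ball (min_le_right _ _) hθ)
  -- a bound, uniform over the ball, for the mean norm of the weighted vector-Jacobian products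
  set bound : C × ℝ → ℝ := fun p =>
    (∫ z, G (p.1, z) ^ 2 ∂pz + b p.1 ^ 2) * (L * |w p.2 * β p.2|) with hbound
  have hbound_int : Integrable bound M :=
    Integrable.mul_prod (f := fun c => ∫ z, G (c, z) ^ 2 ∂pz + b c ^ 2)
      (hG.integrable_sq.integral_prod_left.add hb.integrable_sq) (hβ.abs.const_mul L)
  set S : Vec k → (C × ℝ) × (Z × W) → Vec k := fun θ y =>
    w y.1.2 • scoreMismatchVJP pz F q q0 r τ g θ y.1.1 y.2.1 y.2.2 y.1.2 with hS
  have hSm : ∀ θ, AEStronglyMeasurable (S θ) (M.prod (pz.prod ν)) := fun θ =>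
    (hw.comp (measurable_snd.comp measurable_fst)).aestronglyMeasurable.smul
      (aestronglyMeasurable_scoreMismatchVJP hF hreg hr hZ hg hgd θ)
  have hSle : ∀ᵐ p ∂M, ∀ θ ∈ Metric.ball θ₀ (min ε₁ ε₂),
      Integrable (fun y => S θ (p, y)) (pz.prod ν) ∧
        ∫ y, ‖S θ (p, y)‖ ∂(pz.prod ν) ≤ bound p := by
    filter_upwards [hIoc, hgen, hfish] with p hp hgp hfp θ hθ
    obtain ⟨A, K, D, hk⟩ := hF.exists_isGaussianType hreg hp
    obtain ⟨ε', hgθ⟩ := hgp.exists_of_mem_ball hθ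
    obtain ⟨h1, h2⟩ := (hF.isSampler hreg hp).integrable_scoreVJP hk hgθ
      (rewardTilted (q0 p.1) (fun x₀ => r x₀ p.1) τ) (hfp θ hθ)
    have hSp : (fun y => S θ (p, y)) = fun y => w p.2 • scoreVJP (q p.2) pz
        (fun x₀ ω => F x₀ ω p.2) (fun θ z => g θ z p.1)
        (rewardTilted (q0 p.1) (fun x₀ => r x₀ p.1) τ) θ y := by
      funext y
      simp only [hS]
      rw [scoreMismatchVJP_eq hF hreg hZ θ p.1 hp y]
    rw [hSp]
    refine ⟨h1.smul (w p.2), ?_⟩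
    simp only [congrFun hSp, norm_smul]
    rw [integral_const_mul]
    calc _ ≤ ‖w p.2‖ * (L * |β p.2| * (∫ z, G (p.1, z) ^ 2 ∂pz + b p.1 ^ 2)) := by gcongr
      _ = bound p := by simp only [hbound, Real.norm_eq_abs, abs_mul]; ring
  have hSint : Integrable (S θ₀) (M.prod (pz.prod ν)) := by
    rw [integrable_prod_iff (hSm θ₀)]
    refine ⟨?_, hbound_int.mono' (hSm θ₀).norm.integral_prod_right' ?_⟩
    · filter_upwards [hSle] with p hp using (hp θ₀ (Metric.mem_ball_self hε)).1
    · filter_upwards [hSle] with p hp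
      rw [Real.norm_eq_abs, abs_of_nonneg (integral_nonneg fun y => norm_nonneg _)]
      exact (hp θ₀ (Metric.mem_ball_self hε)).2
  refine ⟨hSint, ?_⟩
  set κ : Vec k → C × ℝ → ℝ≥0∞ := fun θ p => ENNReal.ofReal (w p.2) *
    klDiv (marginalMeasure q (genLaw pz fun z => g θ z p.1) p.2)
      (marginalMeasure q (rewardTilted (q0 p.1) (fun x₀ => r x₀ p.1) τ) p.2) with hκ
  have hκm : ∀ θ, AEMeasurable (κ θ) M := aemeasurable_weight_mul_klDiv hF hreg hr hZ hw hg
  have hlossκ : ∀ θ, loss PC pz T w q q0 r τ g θ = ∫⁻ p, κ θ p ∂M := fun θ =>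
    (lintegral_prod _ (hκm θ)).symm
  have hκfin : ∀ θ, ∫⁻ p, κ θ p ∂M ≠ ∞ := fun θ => by rw [← hlossκ]; exact (hloss θ).ne
  have hlossR : (fun θ => (loss PC pz T w q q0 r τ g θ).toReal)
      = fun θ => ∫ p, (κ θ p).toReal ∂M := by
    funext θ
    rw [hlossκ, integral_toReal (hκm θ) (ae_lt_top' (hκm θ) (hκfin θ))]
  have hderiv : ∀ᵐ p ∂M, ∀ θ ∈ Metric.ball θ₀ (min ε₁ ε₂),
      HasFDerivAt (fun θ => (κ θ p).toReal)
        (InnerProductSpace.toDual ℝ (Vec k) (∫ y, S θ (p, y) ∂(pz.prod ν))) θ := by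
    filter_upwards [hIoc, hgen] with p hp hgp θ hθ
    obtain ⟨A, K, D, hk⟩ := hF.exists_isGaussianType hreg hp
    obtain ⟨ε', hgθ⟩ := hgp.exists_of_mem_ball hθ
    have h := ((hF.isSampler hreg hp).hasFDerivAt_klDiv hk hgθ
      (rewardTilted (q0 p.1) (fun x₀ => r x₀ p.1) τ)).const_mul (w p.2)
    have h1 : (fun θ => (κ θ p).toReal) = fun θ => w p.2 *
        (klDiv (marginalMeasure q (genLaw pz fun z => g θ z p.1) p.2)
          (marginalMeasure q (rewardTilted (q0 p.1) (fun x₀ => r x₀ p.1) τ) p.2)).toReal := by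
      funext θ
      rw [hκ, ENNReal.toReal_mul, ENNReal.toReal_ofReal (hw0 _ hp)]
    have h2 : ∫ y, S θ (p, y) ∂(pz.prod ν) = w p.2 • ∫ y, scoreVJP (q p.2) pz
        (fun x₀ ω => F x₀ ω p.2) (fun θ z => g θ z p.1)
        (rewardTilted (q0 p.1) (fun x₀ => r x₀ p.1) τ) θ y ∂(pz.prod ν) := by
      rw [← integral_smul]
      refine integral_congr_ae (.of_forall fun y => ?_)
      simp only [hS]
      rw [scoreMismatchVJP_eq hF hreg hZ θ p.1 hp y]
    rw [h1, h2, map_smul]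
    exact h
  have hmain := hasFDerivAt_integral_of_dominated_of_fderiv_le (μ := M)
    (F := fun θ p => (κ θ p).toReal)
    (F' := fun θ p => InnerProductSpace.toDual ℝ (Vec k) (∫ y, S θ (p, y) ∂(pz.prod ν)))
    (bound := bound) (Metric.ball_mem_nhds θ₀ hε)
    (.of_forall fun θ => (hκm θ).ennreal_toReal.aestronglyMeasurable)
    (integrable_toReal_of_lintegral_ne_top (hκm θ₀) (hκfin θ₀))
    ((InnerProductSpace.toDual ℝ (Vec k)).continuous.comp_aestronglyMeasurable
      (hSm θ₀).integral_prod_right') (by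
      filter_upwards [hSle] with p hp θ hθ
      rw [LinearIsometryEquiv.norm_map]
      exact (norm_integral_le_integral_norm _).trans (hp θ hθ).2) hbound_int hderiv
  rw [hasGradientAt_iff_hasFDerivAt, hlossR, integral_prod _ hSint]
  have hi := (InnerProductSpace.toDual ℝ (Vec k)).toContinuousLinearEquiv.integral_comp_comm
      (μ := M) (fun p => ∫ y, S θ₀ (p, y) ∂(pz.prod ν))
  exact hi ▸ hmain

end Objective

end DIDR

theorem theorem1 {d k : ℕ} {C Z W : Type*}
    [MeasurableSpace C] [MeasurableSpace Z] [MeasurableSpace W]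
    (PC : Measure C) [IsProbabilityMeasure PC]
    (pz : Measure Z) [IsProbabilityMeasure pz]
    (ν : Measure W) [IsProbabilityMeasure ν]
    (T : ℝ) (hT : 0 < T)
    -- forward noising process and its transition density
    (F : DIDR.Vec d → W → ℝ → DIDR.Vec d) (q : ℝ → DIDR.Vec d → DIDR.Vec d → ℝ) (L : ℝ)
    (hF : DIDR.IsNoisingProcess ν T F q) (hreg : DIDR.IsRegularNoising ν T F q L)
    -- reference data law, reward and temperature, with finite partition function
    (q0 : Kernel C (DIDR.Vec d)) [IsMarkovKernel q0]
    (r : DIDR.Vec d → C → ℝ) (hr : Measurable fun p : DIDR.Vec d × C => r p.1 p.2)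
    (τ : ℝ) (hτ : 0 < τ)
    (hZ : ∀ c, Integrable (fun x₀ => Real.exp (r x₀ c / τ)) (q0 c))
    -- time weight and time sampling density
    (w : ℝ → ℝ) (hw : Measurable w) (hw0 : ∀ t ∈ Ioc 0 T, 0 ≤ w t)
    (η : ℝ → ℝ) (hη : Measurable η) (hη0 : ∀ t ∈ Ioc 0 T, 0 < η t)
    (hη1 : ∫⁻ t in Ioc 0 T, ENNReal.ofReal (η t) = 1)
    -- one-step generator
    (g : DIDR.Vec k → Z → C → DIDR.Vec d)
    (hg : ∀ θ, Measurable fun p : C × Z => g θ p.2 p.1)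
    (hgd : ∀ z c, Differentiable ℝ fun θ => g θ z c)
    (hg2 : ∀ θ, ∀ᵐ c ∂PC, MemLp (fun z => g θ z c) 2 pz)
    (hgG : ∀ θ₀, ∃ ε > 0, ∃ G : C × Z → ℝ, MemLp G 2 (PC.prod pz) ∧
      ∀ᵐ p ∂(PC.prod pz), ∀ θ ∈ Metric.ball θ₀ ε,
        ‖fderiv ℝ (fun θ' => g θ' p.2 p.1) θ‖ ≤ G p)
    -- finite objective and locally bounded relative Fisher information
    (hloss : ∀ θ, DIDR.loss PC pz T w q q0 r τ g θ < ∞)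
    (hfisher : ∀ θ₀, ∃ ε > 0, ∃ (β : ℝ → ℝ) (b : C → ℝ),
      IntegrableOn (fun t => w t * β t) (Ioc 0 T) ∧ MemLp b 2 PC ∧
      ∀ᵐ c ∂PC, ∀ t ∈ Ioc 0 T, ∀ θ ∈ Metric.ball θ₀ ε,
        DIDR.fisherDiv q (DIDR.genLaw pz fun z => g θ z c)
          (DIDR.rewardTilted (q0 c) (fun x₀ => r x₀ c) τ) t ≤ ENNReal.ofReal ((β t * b c) ^ 2)) :
    -- the score-based gradient formula
    (∀ θ,
      Integrable (fun p : C × Z × W × ℝ => (w p.2.2.2 / η p.2.2.2) •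
          DIDR.scoreMismatchVJP pz F q q0 r τ g θ p.1 p.2.1 p.2.2.1 p.2.2.2)
        (PC.prod (pz.prod (ν.prod (DIDR.timeLaw T η)))) ∧
      HasGradientAt (fun θ' => (DIDR.loss PC pz T w q q0 r τ g θ').toReal)
        (∫ p : C × Z × W × ℝ, (w p.2.2.2 / η p.2.2.2) •
            DIDR.scoreMismatchVJP pz F q q0 r τ g θ p.1 p.2.1 p.2.2.1 p.2.2.2
          ∂(PC.prod (pz.prod (ν.prod (DIDR.timeLaw T η))))) θ) ∧
    -- all scores are genuine gradients, and the target score splits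
    (∀ c, ∀ t ∈ Ioc 0 T, ∀ x,
      (∀ θ, 0 < DIDR.marginal q (DIDR.genLaw pz fun z => g θ z c) t x ∧
        DifferentiableAt ℝ
          (fun y => Real.log (DIDR.marginal q (DIDR.genLaw pz fun z => g θ z c) t y)) x) ∧
      0 < DIDR.marginal q (q0 c) t x ∧
      DifferentiableAt ℝ (fun y => Real.log (DIDR.marginal q (q0 c) t y)) x ∧
      Integrable (fun x₀ => Real.exp (r x₀ c / τ)) (DIDR.posterior q (q0 c) t x) ∧
      DifferentiableAt ℝ
        (fun y => Real.log (DIDR.posteriorExpReward q (q0 c) (fun x₀ => r x₀ c) τ t y)) x ∧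
      0 < DIDR.marginal q (DIDR.rewardTilted (q0 c) (fun x₀ => r x₀ c) τ) t x ∧
      DifferentiableAt ℝ (fun y =>
        Real.log (DIDR.marginal q (DIDR.rewardTilted (q0 c) (fun x₀ => r x₀ c) τ) t y)) x ∧
      DIDR.score q (DIDR.rewardTilted (q0 c) (fun x₀ => r x₀ c) τ) t x
        = DIDR.score q (q0 c) t x
          + DIDR.diffusedRewardScore q (q0 c) (fun x₀ => r x₀ c) τ t x) := by
  have hprob : ∀ θ c, IsProbabilityMeasure (DIDR.genLaw pz fun z => g θ z c) := fun θ c =>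
    Measure.isProbabilityMeasure_map
      ((hg θ).comp (by fun_prop : Measurable fun z : Z => (c, z))).aemeasurable
  have hprob' : ∀ c, IsProbabilityMeasure (DIDR.rewardTilted (q0 c) (fun x₀ => r x₀ c) τ) :=
    fun c => isProbabilityMeasure_tilted (hZ c)
  refine ⟨fun θ => ?_, fun c t ht x => ?_⟩
  · have h := DIDR.hasGradientAt_loss hF hreg hr hZ hw hw0 hg hgd (hg2 θ) (hgG θ) hloss (hfisher θ)
    have hint := DIDR.integral_smul_weight (w := w) PC pz ν hη hη0 fun p : C × Z × W × ℝ =>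
      DIDR.scoreMismatchVJP pz F q q0 r τ g θ p.1 p.2.1 p.2.2.1 p.2.2.2
    rw [DIDR.integrable_smul_weight_iff PC pz ν hη hη0 fun p : C × Z × W × ℝ =>
      DIDR.scoreMismatchVJP pz F q q0 r τ g θ p.1 p.2.1 p.2.2.1 p.2.2.2, hint]
    exact h
  · obtain ⟨A, K, D, hk⟩ := hF.exists_isGaussianType hreg ht
    exact ⟨fun θ => ⟨hk.mix_pos _ x, hk.differentiable_log_mix _ x⟩, hk.mix_pos (q0 c) x,
      hk.differentiable_log_mix (q0 c) x, DIDR.integrable_exp_posterior hk (q0 c) (hZ c) x,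
      DIDR.differentiable_log_posteriorExpReward hk (q0 c) (hZ c) x, hk.mix_pos _ x,
      hk.differentiable_log_mix _ x, DIDR.score_rewardTilted hk (q0 c) (hZ c) x⟩
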